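/- Let $d \in \{1,2,\dots\}$, let $r \in (0,\infty)$ and $b \in (0,\infty)$ be real, and for $\boldsymbol p = (p_1,\dots,p_d) \in (0,1)^d$ put $\|\boldsymbol p\|_1 = p_1+\dots+p_d$, $p_0 = 1 - \|\boldsymbol p\|_1$. Let $$\Theta_b = \{\boldsymbol p \in (0,1)^d : \|\boldsymbol p\|_1 < 1 \text{ and } \min(p_0,\dots,p_d) \ge b\}.$$ For $\boldsymbol p \in \Theta_b$ let $\varrho_i = p_i/p_0$, $\boldsymbol\varrho = (\varrho_1,\dots,\varrho_d)^\top$, $\Sigma = \mathrm{diag}(\boldsymbol\varrho) + \boldsymbol\varrho\boldsymbol\varrho^\top$; let $\mathbb P_{r,\boldsymbol p}$ be the negative multinomial law on $\mathbb N_0^d$, which gives $\boldsymbol k = (k_1,\dots,k_d)$ the mass $$\frac{\Gamma(r + k_1 + \dots + k_d)}{\Gamma(r)\prod_{i=1}^d k_i!}\; p_0^{\,r} \prod_{i=1}^d p_i^{k_i},$$ and let $\mathbb Q_{r,\boldsymbol p}$ be the normal law $\mathcal N_d(r\boldsymbol\varrho, r\Sigma)$ on $\mathbb R^d$. Consider the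 experiments $\mathscr P = \{\mathbb P_{r,\boldsymbol p} : \boldsymbol p \in \Theta_b\}$ and $\mathscr Q = \{\mathbb Q_{r,\boldsymbol p} : \boldsymbol p \in \Theta_b\}$, and their Le Cam distance $\Delta(\mathscr P,\mathscr Q) = \max\{\delta(\mathscr P,\mathscr Q), \delta(\mathscr Q,\mathscr P)\}$, where $$\delta(\mathscr P,\mathscr Q) = \inf_{T_1} \sup_{\boldsymbol p \in \Theta_b} \Big\| \int_{\mathbb N_0^d} T_1(\boldsymbol k, \cdot)\, \mathbb P_{r,\boldsymbol p}(\mathrm d\boldsymbol k) - \mathbb Q_{r,\boldsymbol p} \Big\|, \qquad \delta(\mathscr Q,\mathscr P) = \inf_{T_2} \sup_{\boldsymbol p \in \Theta_b} \Big\| \mathbb P_{r,\boldsymbol p} - \int_{\mathbb R^d} T_2(\boldsymbol x, \cdot)\, \mathbb Q_{r,\boldsymbol p}(\mathrm d\boldsymbol x) \Big\|,$$ $\|\cdot\|$ is the total variation norm of a signed measure (the total mass of its variation), and the infima run over all Markov kernels $T_1$ from $\mathbb N_0^d$ to $\mathbb R^d$ and $T_2$ from $\mathbb R^d$ to $\mathbb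 N_0^d$ (suprema over an empty $\Theta_b$ are $0$). Then for every $b \in (0,\infty)$ there is a constant $C_b \in (0,\infty)$, depending only on $b$, such that for all $d \in \{1,2,\dots\}$ and all $r \in (0,\infty)$, $$\Delta(\mathscr P,\mathscr Q) \le C_b\, \frac{d}{\sqrt r}.$$ -/

import Mathlib

open MeasureTheory ProbabilityTheory
open scoped ENNReal Nat

noncomputable section

namespace NegMultinomial

/-! ### Statistical experiments and the Le Cam distance -/

/-- A statistical experiment with parameter set `Θ` and sample space `X`: a family of probability
measures on `X` indexed by `Θ`. -/
abbrev Experiment (Θ X : Type*) [MeasurableSpace X] := Θ → ProbabilityMeasure X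

/-- The total variation norm `‖μ - ν‖` of the signed measure `μ - ν`, that is, the total mass of
its variation `|μ - ν|`. -/
def tvNorm {X : Type*} [MeasurableSpace X] (μ ν : Measure X) [IsFiniteMeasure μ]
    [IsFiniteMeasure ν] : ℝ≥0∞ :=
  (μ.toSignedMeasure - ν.toSignedMeasure).totalVariation Set.univ

/-- The deficiency `δ(P, Q)`: the infimum over all Markov kernels `T` from `X` to `Y` of
`sup_θ ‖∫ T(x, ·) P_θ(dx) - Q_θ‖`. -/
def deficiency {Θ X Y : Type*} [MeasurableSpace X] [MeasurableSpace Y]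
    (P : Experiment Θ X) (Q : Experiment Θ Y) : ℝ≥0∞ :=
  ⨅ (T : Kernel X Y) (_ : IsMarkovKernel T),
    ⨆ θ : Θ, tvNorm (T ∘ₘ (P θ : Measure X)) (Q θ : Measure Y)

/-- The Le Cam distance `Δ(P, Q) = max {δ(P, Q), δ(Q, P)}`. -/
def leCamDist {Θ X Y : Type*} [MeasurableSpace X] [MeasurableSpace Y]
    (P : Experiment Θ X) (Q : Experiment Θ Y) : ℝ≥0∞ :=
  max (deficiency P Q) (deficiency Q P)

/-! ### The parameter set -/

/-- `p₀ = 1 - (p₁ + ⋯ + p_d)`. -/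
def pZero {d : ℕ} (p : Fin d → ℝ) : ℝ := 1 - ∑ i, p i

/-- The set `Θ_b` of all `p ∈ (0,1)^d` with `p₁ + ⋯ + p_d < 1` and `min (p₀, …, p_d) ≥ b`. -/
def paramSet (d : ℕ) (b : ℝ) : Set (Fin d → ℝ) :=
  {p | (∀ i, p i ∈ Set.Ioo (0 : ℝ) 1) ∧ ∑ i, p i < 1 ∧ b ≤ pZero p ∧ ∀ i, b ≤ p i}

/-! ### The negative multinomial distribution -/

/-- The negative multinomial probability mass function with parameters `r` and `p`. -/
def nmPMF {d : ℕ} (r : ℝ) (p : Fin d → ℝ) (k : Fin d → ℕ) : ℝ :=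
  Real.Gamma (r + ∑ i, (k i : ℝ)) / (Real.Gamma r * ∏ i, ((k i)! : ℝ)) *
    pZero p ^ r * ∏ i, p i ^ k i

/-- The negative multinomial law on `ℕ^d`. -/
def nmMeasure {d : ℕ} (r : ℝ) (p : Fin d → ℝ) : Measure (Fin d → ℕ) :=
  Measure.sum fun k ↦ ENNReal.ofReal (nmPMF r p k) • Measure.dirac k

lemma nmPMF_nonneg {d : ℕ} {r : ℝ} (hr : 0 < r) {p : Fin d → ℝ} (hp : ∀ i, 0 ≤ p i)
    (hs : ∑ i, p i < 1) (k : Fin d → ℕ) : 0 ≤ nmPMF r p k := by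
  have h1 : 0 < Real.Gamma (r + ∑ i, (k i : ℝ)) := Real.Gamma_pos_of_pos (by positivity)
  have h2 : 0 < Real.Gamma r := Real.Gamma_pos_of_pos hr
  have h3 : 0 < pZero p := by unfold pZero; linarith
  have h4 : 0 ≤ ∏ i, p i ^ k i := Finset.prod_nonneg fun i _ ↦ pow_nonneg (hp i) _
  unfold nmPMF
  positivity

lemma gamma_add_nat {r : ℝ} (hr : 0 < r) (n : ℕ) :
    Real.Gamma (r + n) = n ! * Ring.choose (r + n - 1) n * Real.Gamma r := by
  have h : (n ! : ℝ) * Ring.choose (r + n - 1) n = (ascPochhammer ℕ n).smeval r := by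
    rw [← Ring.multichoose_eq, ← Ring.factorial_nsmul_multichoose_eq_ascPochhammer, nsmul_eq_mul]
  rw [h]
  induction n with
  | zero => simp
  | succ n ih =>
    rw [ascPochhammer_succ_right, Nat.cast_succ, ← add_assoc,
      Real.Gamma_add_one (by positivity), ih ?_, Polynomial.smeval_mul, Polynomial.smeval_add,
      Polynomial.smeval_X, Polynomial.smeval_natCast]
    · simp
      ring
    · rw [← Ring.multichoose_eq, ← Ring.factorial_nsmul_multichoose_eq_ascPochhammer, nsmul_eq_mul]

lemma hasSum_negBinomial {r s : ℝ} (h0 : 0 ≤ s) (h1 : s < 1) :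
    HasSum (fun n : ℕ ↦ Ring.choose (r + n - 1) n * (1 - s) ^ r * s ^ n) 1 := by
  have h := (Real.one_div_one_sub_rpow_hasFPowerSeriesOnBall_zero r).hasSum (y := s) (by
    rw [Metric.mem_eball, edist_zero_right, ← ofReal_norm, Real.norm_of_nonneg h0]
    simpa using h1)
  simp only [FormalMultilinearSeries.ofScalars_apply_eq, zero_add, smul_eq_mul] at h
  have h' := h.mul_left ((1 - s) ^ r)
  have hpos : 0 < (1 - s) ^ r := Real.rpow_pos_of_pos (by linarith) r
  rw [mul_one_div, div_self hpos.ne'] at h'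
  refine h'.congr_fun ?_
  intro n
  ring

lemma sum_nmPMF_piAntidiag {d : ℕ} {r : ℝ} (hr : 0 < r) (p : Fin d → ℝ) (n : ℕ) :
    ∑ k ∈ Finset.piAntidiag Finset.univ n, nmPMF r p k =
      Ring.choose (r + n - 1) n * pZero p ^ r * (∑ i, p i) ^ n := by
  rw [Finset.sum_pow_eq_sum_piAntidiag, Finset.mul_sum]
  refine Finset.sum_congr rfl fun k hk ↦ ?_
  have hk' : ∑ i, k i = n := by simpa using hk
  have hm : (∏ i, ((k i)! : ℝ)) * Nat.multinomial Finset.univ k = (n ! : ℝ) := by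
    rw [← hk']
    exact_mod_cast Nat.multinomial_spec Finset.univ k
  have hG : Real.Gamma r ≠ 0 := (Real.Gamma_pos_of_pos hr).ne'
  have hF : (∏ i, ((k i)! : ℝ)) ≠ 0 := Finset.prod_ne_zero_iff.2 fun i _ ↦ by positivity
  rw [nmPMF, ← Nat.cast_sum, hk', gamma_add_nat hr, ← hm]
  field_simp

/-- The negative multinomial masses add up to one. -/
lemma hasSum_nmPMF {d : ℕ} {r : ℝ} (hr : 0 < r) {p : Fin d → ℝ} (hp : ∀ i, 0 ≤ p i)
    (hs : ∑ i, p i < 1) :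
    HasSum (fun k : Fin d → ℕ ↦ ENNReal.ofReal (nmPMF r p k)) 1 := by
  rw [ENNReal.summable.hasSum_iff, ← ENNReal.tsum_fiberwise _ fun k : Fin d → ℕ ↦ ∑ i, k i]
  have hfib (n : ℕ) : ∑' k : (fun k : Fin d → ℕ ↦ ∑ i, k i) ⁻¹' {n},
      ENNReal.ofReal (nmPMF r p k) =
      ENNReal.ofReal (Ring.choose (r + n - 1) n * pZero p ^ r * (∑ i, p i) ^ n) := by
    have hset : (fun k : Fin d → ℕ ↦ ∑ i, k i) ⁻¹' {n} =
        (Finset.piAntidiag (Finset.univ : Finset (Fin d)) n : Set (Fin d → ℕ)) := by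
      ext k
      simp
    rw [hset, ← sum_nmPMF_piAntidiag hr,
      ENNReal.ofReal_sum_of_nonneg fun k _ ↦ nmPMF_nonneg hr hp hs k]
    exact Finset.tsum_subtype' _ fun k ↦ ENNReal.ofReal (nmPMF r p k)
  simp_rw [hfib]
  have h : HasSum (fun n : ℕ ↦
      Ring.choose (r + n - 1) n * pZero p ^ r * (∑ i, p i) ^ n) 1 :=
    hasSum_negBinomial (Finset.sum_nonneg fun i _ ↦ hp i) hs
  rw [← ENNReal.ofReal_tsum_of_nonneg _ h.summable]
  · exact (congrArg ENNReal.ofReal h.tsum_eq).trans ENNReal.ofReal_one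
  · intro n
    rw [← sum_nmPMF_piAntidiag hr]
    exact Finset.sum_nonneg fun k _ ↦ nmPMF_nonneg hr hp hs k

lemma isProbabilityMeasure_nmMeasure {d : ℕ} {r : ℝ} (hr : 0 < r) {p : Fin d → ℝ}
    (hp : ∀ i, 0 ≤ p i) (hs : ∑ i, p i < 1) : IsProbabilityMeasure (nmMeasure r p) :=
  (hasSum_nmPMF hr hp hs).isProbabilityMeasure_sum_dirac_ennreal

/-- The experiment `{NM(r, p) : p ∈ Θ_b}`. -/
def nmExperiment (d : ℕ) (b r : ℝ) (hr : 0 < r) : Experiment (paramSet d b) (Fin d → ℕ) :=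
  fun p ↦ ⟨nmMeasure r p.1,
    isProbabilityMeasure_nmMeasure hr (fun i ↦ (p.2.1 i).1.le) p.2.2.1⟩

/-! ### The multivariate normal experiment -/

/-- `ϱ_i = p_i / p₀`. -/
def rho {d : ℕ} (p : Fin d → ℝ) : Fin d → ℝ := fun i ↦ p i / pZero p

/-- `Σ = diag(ϱ) + ϱ ϱᵀ`. -/
def covMatrix {d : ℕ} (p : Fin d → ℝ) : Matrix (Fin d) (Fin d) ℝ :=
  Matrix.diagonal (rho p) + Matrix.vecMulVec (rho p) (rho p)

/-- The experiment `{N_d(r ϱ, r Σ) : p ∈ Θ_b}`. -/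
def gaussExperiment (d : ℕ) (b r : ℝ) :
    Experiment (paramSet d b) (EuclideanSpace ℝ (Fin d)) :=
  fun p ↦ ⟨multivariateGaussian (WithLp.toLp 2 (r • rho p.1)) (r • covMatrix p.1), inferInstance⟩

end NegMultinomial

end

/-! A single one-sided estimate controls both deficiencies. Let `cubeKernel` spread the atom at k
uniformly over the unit cube with lower corner k; taking integer parts (`floorMap`) undoes this.
Since probability measures with μ A ≤ ν A + E for all measurable A satisfy ‖μ - ν‖ ≤ 2E
(`tvNorm_le_of_forall_le_add`), it is enough that the normal law exceeds the smoothed negative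
multinomial law by at most O_b(d / √r) on every measurable set (`gaussLaw_le_add`). No tail bound
for the negative multinomial law is needed.

The estimate rests on a pointwise bound: near the mean, the mass at ⌊y⌋ is at least the normal
density at y times 1 - ε(y), where ε is `localError` (`gaussDensity_mul_one_sub_le`). Put ψ(t) = (1
+ t) log (1 + t), and let tᵢ, t₀ be the relative deviations of kᵢ from r ϱᵢ and of r + ∑ kᵢ from r /
p₀. Up to normalising terms, Stirling turns the log mass into (r / p₀) ψ(t₀) - ∑ r ϱᵢ ψ(tᵢ). The
linear terms cancel, and the quadratic ones are the normal exponent because Σ⁻¹ = diag(1 / ϱ) - p₀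
11ᵀ. Cubic remainders, Stirling errors and rounding go into ε. Far from the mean ε ≥ 1, and the
bound is trivial.

With W = d + ‖y - r ϱ‖₁, ε has order W / r + W³ / r² for fixed b. Under the normal law each
coordinate deviates by O_b(√r), and d ≤ 1 / b, so ε has mean O_b(d / √r)
(`lintegral_localError_le`). For r < 2 the bound 2 on the total variation norm suffices. -/

/-! ### Total variation norm -/

namespace NegMultinomial

lemma tvNorm_le_of_forall_le_add {X : Type*} [MeasurableSpace X] {μ ν : Measure X}
    [IsProbabilityMeasure μ] [IsProbabilityMeasure ν] {E : ℝ} (hE : 0 ≤ E)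
    (h : ∀ A, MeasurableSet A → μ A ≤ ν A + ENNReal.ofReal E) :
    tvNorm μ ν ≤ ENNReal.ofReal (2 * E) := by
  have h' (A : Set X) (hA : MeasurableSet A) : μ.real A ≤ ν.real A + E := by
    have := ENNReal.toReal_mono (by finiteness) (h A hA)
    rwa [ENNReal.toReal_add (by finiteness) (by finiteness), ENNReal.toReal_ofReal hE] at this
  set s := μ.toSignedMeasure - ν.toSignedMeasure with hs
  have hsA (A : Set X) (hA : MeasurableSet A) : s A = μ.real A - ν.real A :=
    Measure.toSignedMeasure_sub_apply hA
  obtain ⟨i, hi, hi0, hi1, hp, hn⟩ := s.toJordanDecomposition_spec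
  have e1 : s.toJordanDecomposition.posPart Set.univ = ENNReal.ofReal (s i) := by
    rw [← ENNReal.ofReal_toReal (measure_ne_top _ Set.univ), hp, ← measureReal_def,
      SignedMeasure.toMeasureOfZeroLE_real_apply _ hi0 hi MeasurableSet.univ, Set.inter_univ]
  have e2 : s.toJordanDecomposition.negPart Set.univ = ENNReal.ofReal (- s iᶜ) := by
    rw [← ENNReal.ofReal_toReal (measure_ne_top _ Set.univ), hn, ← measureReal_def,
      SignedMeasure.toMeasureOfLEZero_real_apply _ hi1 hi.compl MeasurableSet.univ, Set.inter_univ]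
  -- Both measures have mass one, so the positive and negative parts weigh the same; this gives the
  -- factor 2.
  have e3 : - s iᶜ = s i := by
    rw [hsA _ hi, hsA _ hi.compl, probReal_compl_eq_one_sub hi, probReal_compl_eq_one_sub hi]
    ring
  have e4 : s i ≤ E := by
    rw [hsA _ hi]
    linarith [h' i hi]
  rw [tvNorm, ← hs, SignedMeasure.totalVariation, Measure.add_apply, e1, e2, e3]
  rw [two_mul, ENNReal.ofReal_add hE hE]
  gcongr

lemma tvNorm_comm {X : Type*} [MeasurableSpace X] (μ ν : Measure X)
    [IsFiniteMeasure μ] [IsFiniteMeasure ν] : tvNorm μ ν = tvNorm ν μ := by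
  rw [tvNorm, tvNorm, ← neg_sub, SignedMeasure.totalVariation_neg]

lemma tvNorm_le_two {X : Type*} [MeasurableSpace X] (μ ν : Measure X)
    [IsProbabilityMeasure μ] [IsProbabilityMeasure ν] : tvNorm μ ν ≤ ENNReal.ofReal 2 := by
  have := tvNorm_le_of_forall_le_add (μ := μ) (ν := ν) zero_le_one fun A _ ↦ by
    rw [ENNReal.ofReal_one]
    exact prob_le_one.trans le_add_self
  simpa using this

end NegMultinomial

/-! ### Lebesgue density of the multivariate normal law -/

namespace NegMultinomial

lemma pi_gaussianReal_eq_withDensity (ι : Type*) [Fintype ι] :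
    Measure.pi (fun _ : ι ↦ gaussianReal 0 1) =
      volume.withDensity fun x : ι → ℝ ↦ ENNReal.ofReal (∏ i, gaussianPDFReal 0 1 (x i)) := by
  refine (Measure.pi_eq fun s hs ↦ ?_)
  rw [withDensity_apply _ (MeasurableSet.univ_pi hs),
    ← lintegral_indicator (MeasurableSet.univ_pi hs)]
  have h1 : (Set.univ.pi s).indicator
      (fun x : ι → ℝ ↦ ENNReal.ofReal (∏ i, gaussianPDFReal 0 1 (x i))) =
      fun x ↦ ENNReal.ofReal (∏ i, (s i).indicator (gaussianPDFReal 0 1) (x i)) := by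
    ext x
    by_cases hx : x ∈ Set.univ.pi s
    · rw [Set.indicator_of_mem hx]
      congr 1
      exact Finset.prod_congr rfl fun i _ ↦ (Set.indicator_of_mem (hx i trivial) _).symm
    · rw [Set.indicator_of_notMem hx]
      simp only [Set.mem_univ_pi, not_forall] at hx
      obtain ⟨i, hi⟩ := hx
      rw [Finset.prod_eq_zero (Finset.mem_univ i) (Set.indicator_of_notMem hi _),
        ENNReal.ofReal_zero]
  have hnn (i : ι) (y : ℝ) : 0 ≤ (s i).indicator (gaussianPDFReal 0 1) y :=
    Set.indicator_nonneg (fun _ _ ↦ gaussianPDFReal_nonneg _ _ _) _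
  have hint (i : ι) : Integrable ((s i).indicator (gaussianPDFReal 0 1)) volume :=
    (integrable_gaussianPDFReal 0 1).indicator (hs i)
  rw [h1, ← ofReal_integral_eq_lintegral_ofReal (by rw [volume_pi]; exact Integrable.fintype_prod hint)
    (ae_of_all _ fun x ↦ Finset.prod_nonneg fun i _ ↦ hnn i _),
    integral_fintype_prod_volume_eq_prod, ENNReal.ofReal_prod_of_nonneg]
  · refine Finset.prod_congr rfl fun i _ ↦ ?_
    rw [gaussianReal_apply_eq_integral _ one_ne_zero, integral_indicator (hs i)]
  · exact fun i _ ↦ integral_nonneg (hnn i)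

open Matrix in
/-- The density of a nondegenerate multivariate Gaussian law, with respect to Lebesgue measure. -/
noncomputable def gaussDensity {ι : Type*} [Fintype ι] [DecidableEq ι] (m : ι → ℝ) (S : Matrix ι ι ℝ)
    (y : ι → ℝ) : ℝ :=
  ((√(2 * Real.pi))⁻¹ ^ Fintype.card ι) * (√S.det)⁻¹ *
    Real.exp (-((y - m) ⬝ᵥ (S⁻¹ *ᵥ (y - m))) / 2)

lemma measurable_gaussDensity {ι : Type*} [Fintype ι] [DecidableEq ι] (m : ι → ℝ)
    (S : Matrix ι ι ℝ) : Measurable (gaussDensity m S) := by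
  unfold gaussDensity
  apply Continuous.measurable
  fun_prop

open Matrix in
open scoped MatrixOrder in
-- The law is the image of the standard normal law under x ↦ m + √S x, so the linear change of
-- variables and a translation give the density.
lemma lintegral_multivariateGaussian {ι : Type*} [Fintype ι] [DecidableEq ι] (m : ι → ℝ)
    {S : Matrix ι ι ℝ} (hS : S.PosDef) {f : EuclideanSpace ℝ ι → ℝ≥0∞} (hf : Measurable f) :
    ∫⁻ x, f x ∂(multivariateGaussian (WithLp.toLp 2 m) S) =
      ∫⁻ y : ι → ℝ, f (WithLp.toLp 2 y) * ENNReal.ofReal (gaussDensity m S y) := by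
  set B := CFC.sqrt S with hB
  have hBB : B * B = S := CFC.sqrt_mul_sqrt_self S hS.posSemidef.nonneg
  have hBs : Bᵀ = B := by
    have : IsSelfAdjoint B := (CFC.sqrt_nonneg S).isSelfAdjoint
    have h2 : Bᴴ = B := this
    rwa [conjTranspose_eq_transpose_of_trivial] at h2
  have hdet : B.det * B.det = S.det := by rw [← det_mul, hBB]
  have hdS : 0 < S.det := hS.det_pos
  have hd0 : B.det ≠ 0 := fun h ↦ by rw [h] at hdet; simp at hdet; linarith
  have hSinv : S⁻¹ = B⁻¹ * B⁻¹ := by rw [← hBB, Matrix.mul_inv_rev]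
  have hBu : IsUnit B.det := hd0.isUnit
  have hsq : √S.det = |B.det| := by rw [← hdet, Real.sqrt_mul_self_eq_abs]
  set dens : (ι → ℝ) → ℝ := fun x ↦ ∏ i, gaussianPDFReal 0 1 (x i) with hdens
  have hdensm : Measurable dens := by
    rw [hdens]; exact Finset.measurable_prod _ fun i _ ↦
      (measurable_gaussianPDFReal 0 1).comp (measurable_pi_apply i)
  have hdens' (x : ι → ℝ) : dens x = (√(2 * Real.pi))⁻¹ ^ Fintype.card ι * Real.exp (-(x ⬝ᵥ x) / 2) := by
    simp only [hdens, gaussianPDFReal, Finset.prod_mul_distrib, ← Real.exp_sum, dotProduct]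
    simp [Finset.sum_div, Finset.sum_neg_distrib, neg_div, sq]
  rw [multivariateGaussian, lintegral_map hf (by fun_prop), ← map_pi_eq_stdGaussian,
    lintegral_map (by fun_prop) (by fun_prop), pi_gaussianReal_eq_withDensity,
    lintegral_withDensity_eq_lintegral_mul _ (by fun_prop) (by fun_prop)]
  set F : (ι → ℝ) → ℝ≥0∞ := fun y ↦
    f (WithLp.toLp 2 (m + y)) * ENNReal.ofReal (dens (B⁻¹ *ᵥ y)) with hF
  have hFm : Measurable F := by
    have : Measurable fun y ↦ B⁻¹ *ᵥ y := Continuous.measurable (by fun_prop)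
    fun_prop
  have e1 (x : ι → ℝ) : ((fun x ↦ ENNReal.ofReal (dens x)) * fun a ↦
      f (WithLp.toLp 2 m + (toEuclideanCLM (𝕜 := ℝ) B) (WithLp.toLp 2 a))) x =
      F (toLin' B x) := by
    simp only [hF, Pi.mul_apply, toLin'_apply, mulVec_mulVec, nonsing_inv_mul _ hBu, one_mulVec]
    rw [mul_comm, toEuclideanCLM_toLp, ← WithLp.toLp_add]
  -- Substituting y = B x produces the Jacobian |det B|⁻¹ = (√det S)⁻¹.
  rw [lintegral_congr e1, ← lintegral_map hFm (by fun_prop),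
    Real.map_matrix_volume_pi_eq_smul_volume_pi hd0, lintegral_smul_measure, smul_eq_mul,
    ← lintegral_const_mul _ hFm]
  rw [← lintegral_add_left_eq_self (fun y ↦ f (WithLp.toLp 2 y) *
    ENNReal.ofReal (gaussDensity m S y)) m]
  refine lintegral_congr fun y ↦ ?_
  have hquad : (B⁻¹ *ᵥ y) ⬝ᵥ (B⁻¹ *ᵥ y) = y ⬝ᵥ (S⁻¹ *ᵥ y) := by
    rw [hSinv, ← mulVec_mulVec, dotProduct_mulVec y, ← mulVec_transpose, transpose_nonsing_inv,
      hBs]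
  rw [hF]
  simp only
  rw [mul_left_comm, ← ENNReal.ofReal_mul (abs_nonneg _), hdens', hquad, gaussDensity, hsq,
    add_sub_cancel_left, abs_inv]
  congr 2
  ring

end NegMultinomial

/-! ### Determinant and inverse of Σ, logarithm of the normal density -/

namespace NegMultinomial

section Covariance

variable {d : ℕ} {p : Fin d → ℝ}

lemma pZero_pos (hs : ∑ i, p i < 1) : 0 < pZero p := by unfold pZero; linarith

lemma rho_pos (hp : ∀ i, 0 < p i) (hs : ∑ i, p i < 1) (i : Fin d) : 0 < rho p i :=
  div_pos (hp i) (pZero_pos hs)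

lemma one_add_sum_rho (hs : ∑ i, p i < 1) : 1 + ∑ i, rho p i = (pZero p)⁻¹ := by
  have h := (pZero_pos hs).ne'
  simp only [rho, ← Finset.sum_div]
  field_simp
  simp [pZero]

open Matrix

lemma posDef_covMatrix (hp : ∀ i, 0 < p i) (hs : ∑ i, p i < 1) : (covMatrix p).PosDef := by
  refine PosDef.add_posSemidef (PosDef.diagonal fun i ↦ rho_pos hp hs i) ?_
  simpa using posSemidef_vecMulVec_self_star (rho p)

/-- Matrix determinant lemma for a rank-one update: the extra factor is 1 + ∑ ϱᵢ = 1 / p₀. -/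
lemma det_covMatrix (hp : ∀ i, 0 < p i) (hs : ∑ i, p i < 1) :
    (covMatrix p).det = (∏ i, rho p i) * (pZero p)⁻¹ := by
  have hne (i : Fin d) : rho p i ≠ 0 := (rho_pos hp hs i).ne'
  have hu : IsUnit (diagonal (rho p)).det := by
    rw [det_diagonal]
    exact (Finset.prod_ne_zero_iff.2 fun i _ ↦ hne i).isUnit
  rw [covMatrix, vecMulVec_eq Unit, det_add_replicateCol_mul_replicateRow hu, det_diagonal,
    ← one_add_sum_rho hs]
  congr 1
  have hinv : (diagonal (rho p))⁻¹ = diagonal fun i ↦ (rho p i)⁻¹ := by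
    refine inv_eq_right_inv ?_
    rw [diagonal_mul_diagonal, ← diagonal_one]
    congr 1
    ext i
    exact mul_inv_cancel₀ (hne i)
  rw [hinv, det_unique]
  simp [Matrix.mul_apply, hne, diagonal_apply]

/-- Sherman–Morrison: diag(ϱ)⁻¹ ϱ is the all-ones vector, and the coefficient 1 / (1 + ∑ ϱᵢ) equals
p₀. -/
lemma inv_covMatrix (hp : ∀ i, 0 < p i) (hs : ∑ i, p i < 1) :
    (covMatrix p)⁻¹ = diagonal (fun i ↦ (rho p i)⁻¹) - pZero p • vecMulVec 1 1 := by
  have hne (i : Fin d) : rho p i ≠ 0 := (rho_pos hp hs i).ne'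
  refine inv_eq_right_inv ?_
  have h0 := (pZero_pos hs).ne'
  have h1 : ∑ i, rho p i = (pZero p)⁻¹ - 1 := by linarith [one_add_sum_rho hs]
  ext i j
  simp only [covMatrix, Matrix.add_mul, Matrix.mul_sub, Matrix.add_apply, Matrix.sub_apply,
    diagonal_mul_diagonal, Matrix.mul_smul, Matrix.smul_apply, smul_eq_mul, diagonal_mul,
    vecMulVec_apply, Matrix.mul_diagonal, Pi.one_apply, mul_one, vecMulVec_mul_vecMulVec,
    dotProduct, h1]
  rw [mul_inv_cancel_right₀ (hne j)]
  by_cases hij : i = j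
  · subst hij
    simp [hne i]
    field_simp
    ring
  · simp [hij]
    field_simp
    ring

lemma log_gaussDensity (hp : ∀ i, 0 < p i) (hs : ∑ i, p i < 1) {r : ℝ} (hr : 0 < r)
    (y : Fin d → ℝ) :
    Real.log (gaussDensity (r • rho p) (r • covMatrix p) y) =
      -(d * Real.log (2 * Real.pi) / 2) - d * Real.log r / 2 -
        (∑ i, Real.log (rho p i) - Real.log (pZero p)) / 2 -
        (∑ i, (y i - r * rho p i) ^ 2 / rho p i -
          pZero p * (∑ i, (y i - r * rho p i)) ^ 2) / (2 * r) := by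
  have hne (i : Fin d) : rho p i ≠ 0 := (rho_pos hp hs i).ne'
  have h0 := pZero_pos hs
  have hprod : 0 < ∏ i, rho p i := Finset.prod_pos fun i _ ↦ rho_pos hp hs i
  have hdet : (r • covMatrix p).det = r ^ d * ((∏ i, rho p i) * (pZero p)⁻¹) := by
    rw [det_smul, det_covMatrix hp hs, Fintype.card_fin]
  have hdpos : 0 < r ^ d * ((∏ i, rho p i) * (pZero p)⁻¹) := by positivity
  have hinv : (r • covMatrix p)⁻¹ =
      r⁻¹ • (diagonal (fun i ↦ (rho p i)⁻¹) - pZero p • vecMulVec 1 1) := by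
    rw [← inv_covMatrix hp hs]
    have hu : IsUnit (covMatrix p).det := (posDef_covMatrix hp hs).det_pos.ne'.isUnit
    refine inv_eq_right_inv ?_
    rw [Matrix.smul_mul, Matrix.mul_smul, smul_smul, mul_inv_cancel₀ hr.ne', one_smul,
      mul_nonsing_inv _ hu]
  have hquad : (y - r • rho p) ⬝ᵥ ((r • covMatrix p)⁻¹ *ᵥ (y - r • rho p)) =
      (∑ i, (y i - r * rho p i) ^ 2 / rho p i -
          pZero p * (∑ i, (y i - r * rho p i)) ^ 2) / r := by
    rw [hinv, smul_mulVec, dotProduct_smul, sub_mulVec, dotProduct_sub, smul_mulVec,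
      dotProduct_smul, vecMulVec_mulVec]
    simp only [dotProduct, mulVec_diagonal, Pi.sub_apply, Pi.smul_apply, smul_eq_mul, Pi.one_apply,
      one_mul, MulOpposite.smul_eq_mul_unop, MulOpposite.unop_op, ← Finset.sum_mul]
    rw [div_eq_inv_mul]
    congr 2
    · exact Finset.sum_congr rfl fun i _ ↦ by rw [div_eq_inv_mul]; ring
    · rw [sq]
  rw [gaussDensity, hquad, hdet, Real.log_mul (by positivity) (Real.exp_pos _).ne', Real.log_exp,
    Real.log_mul (by positivity) (by positivity), Real.log_pow, Real.log_inv, Real.log_inv,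
    Real.log_sqrt (by positivity), Real.log_sqrt hdpos.le, Real.log_mul (pow_pos hr d).ne'
    (by positivity), Real.log_mul hprod.ne' (by positivity), Real.log_inv, Real.log_pow,
    Real.log_prod (fun i _ ↦ hne i), Fintype.card_fin]
  field_simp
  ring

lemma gaussDensity_pos (hp : ∀ i, 0 < p i) (hs : ∑ i, p i < 1) {r : ℝ} (hr : 0 < r)
    (y : Fin d → ℝ) : 0 < gaussDensity (r • rho p) (r • covMatrix p) y := by
  have := ((posDef_covMatrix hp hs).smul hr).det_pos
  unfold gaussDensity
  positivity

end Covariance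

end NegMultinomial

/-! ### Logarithmic expansions and Stirling bounds -/

namespace NegMultinomial

lemma abs_log_one_add_sub_le {t : ℝ} (ht : |t| ≤ 1 / 2) :
    |Real.log (1 + t) - (t - t ^ 2 / 2)| ≤ 2 * |t| ^ 3 := by
  have h := Real.abs_log_sub_add_sum_range_le (x := -t) (by rw [abs_neg]; linarith) 2
  rw [abs_neg, sub_neg_eq_add] at h
  have e : ∑ i ∈ Finset.range 2, (-t) ^ (i + 1) / ((i : ℝ) + 1) = -(t - t ^ 2 / 2) := by
    simp [Finset.sum_range_succ]
    ring
  rw [e, neg_add_eq_sub] at h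
  refine h.trans ?_
  rw [div_le_iff₀ (by linarith)]
  have h3 : 0 ≤ |t| ^ 3 * (1 / 2 - |t|) := mul_nonneg (by positivity) (by linarith)
  have h4 : |t| ^ (2 + 1) = |t| ^ 3 := rfl
  rw [h4]
  linarith

lemma abs_one_add_mul_log_sub_le {t : ℝ} (ht : |t| ≤ 1 / 2) :
    |(1 + t) * Real.log (1 + t) - t - t ^ 2 / 2| ≤ 4 * |t| ^ 3 := by
  have h := abs_log_one_add_sub_le ht
  have e : (1 + t) * Real.log (1 + t) - t - t ^ 2 / 2 =
      (1 + t) * (Real.log (1 + t) - (t - t ^ 2 / 2)) - t ^ 3 / 2 := by ring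
  have h1 : |1 + t| ≤ 3 / 2 := by
    rw [abs_le] at ht ⊢
    constructor <;> linarith
  calc _ ≤ |(1 + t) * (Real.log (1 + t) - (t - t ^ 2 / 2))| + |t ^ 3 / 2| := by
        rw [e]; exact abs_sub _ _
    _ ≤ 3 / 2 * (2 * |t| ^ 3) + |t| ^ 3 / 2 := by
        rw [abs_mul, abs_div, abs_pow, abs_two]
        gcongr
    _ ≤ _ := by nlinarith [pow_nonneg (abs_nonneg t) 3]

/-- Since 1 / (12 m (m + 1)) telescopes, log `stirlingSeq` n - 1 / (12 n) increases, and its limit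
is log √π. -/
lemma log_stirlingSeq_le {n : ℕ} (hn : n ≠ 0) :
    Real.log (Stirling.stirlingSeq n) ≤ Real.log √Real.pi + 1 / (12 * n) := by
  have hmono : Monotone fun m : ℕ ↦
      Real.log (Stirling.stirlingSeq (m + 1)) - 1 / (12 * ((m + 1 : ℕ) : ℝ)) := by
    refine monotone_nat_of_le_succ fun m ↦ ?_
    have h := Stirling.log_stirlingSeq_sdiff_le (m + 1)
    have e : (1 : ℝ) / (12 * ((m + 1 : ℕ) : ℝ) * ((m + 1 : ℕ) + 1)) =
        1 / (12 * ((m + 1 : ℕ) : ℝ)) - 1 / (12 * ((m + 1 + 1 : ℕ) : ℝ)) := by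
      push_cast
      field_simp
      ring
    rw [e] at h
    linarith
  have hlim : Filter.Tendsto (fun m : ℕ ↦
      Real.log (Stirling.stirlingSeq (m + 1)) - 1 / (12 * ((m + 1 : ℕ) : ℝ))) Filter.atTop
      (nhds (Real.log √Real.pi - 0)) := by
    refine Filter.Tendsto.sub ?_ ?_
    · exact ((Real.continuousAt_log (by positivity)).tendsto.comp
        Stirling.tendsto_stirlingSeq_sqrt_pi).comp (Filter.tendsto_add_atTop_nat 1)
    · have := ((tendsto_one_div_atTop_nhds_zero_nat (𝕜 := ℝ)).comp
        (Filter.tendsto_add_atTop_nat 1)).const_mul (1 / 12)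
      simp only [mul_zero] at this
      refine this.congr fun m ↦ ?_
      simp only [Function.comp]
      field_simp
  obtain ⟨m, rfl⟩ := Nat.exists_eq_succ_of_ne_zero hn
  have := hmono.ge_of_tendsto hlim m
  simp only [Nat.succ_eq_add_one]
  linarith

lemma log_factorial_le {n : ℕ} (hn : n ≠ 0) :
    Real.log (n ! : ℝ) ≤ n * Real.log n - n + Real.log n / 2 + Real.log (2 * Real.pi) / 2 +
      1 / (12 * n) := by
  have h := log_stirlingSeq_le hn
  have hn' : (n : ℝ) ≠ 0 := by exact_mod_cast hn
  rw [Stirling.log_stirlingSeq_formula, Real.log_sqrt Real.pi_pos.le,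
    Real.log_div hn' (Real.exp_pos 1).ne', Real.log_exp, Real.log_mul two_ne_zero hn'] at h
  rw [Real.log_mul two_ne_zero Real.pi_ne_zero]
  linarith

lemma add_half_mul_log_one_add_inv_le {x : ℝ} (hx : 2 ≤ x) :
    (x + 1 / 2) * Real.log (1 + x⁻¹) - 1 ≤ 3 / x ^ 2 := by
  have hx0 : 0 < x := by linarith
  have hi : 0 < x⁻¹ := by positivity
  have hi2 : x⁻¹ ≤ 1 / 2 := by rw [one_div]; exact inv_anti₀ two_pos hx
  have h := (abs_le.1 (abs_log_one_add_sub_le (t := x⁻¹) (by rwa [abs_of_pos hi]))).2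
  rw [abs_of_pos hi] at h
  have h2 : Real.log (1 + x⁻¹) ≤ x⁻¹ - x⁻¹ ^ 2 / 2 + 2 * x⁻¹ ^ 3 := by linarith
  calc _ ≤ (x + 1 / 2) * (x⁻¹ - x⁻¹ ^ 2 / 2 + 2 * x⁻¹ ^ 3) - 1 := by gcongr
    _ = x⁻¹ ^ 2 * (7 / 4 + x⁻¹) := by field_simp; ring
    _ ≤ x⁻¹ ^ 2 * 3 := by gcongr; linarith
    _ = _ := by field_simp

/-- Only a ratio of Gamma values at integer distance occurs, so the functional equation replaces
Stirling's formula at real arguments. Each unit step from x costs at most 3 / x² ≤ 3 / r². -/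
lemma le_log_Gamma_add_nat_sub {r : ℝ} (hr : 2 ≤ r) (n : ℕ) :
    (r + n - 1 / 2) * Real.log (r + n) - (r + n) - ((r - 1 / 2) * Real.log r - r) - 3 * n / r ^ 2 ≤
      Real.log (Real.Gamma (r + n)) - Real.log (Real.Gamma r) := by
  induction n with
  | zero => simp
  | succ n ih =>
    have hx : 2 ≤ r + n := by linarith [(Nat.cast_nonneg n : (0 : ℝ) ≤ n)]
    set x := r + n with hxd
    have hx0 : 0 < x := by linarith
    have h1 := add_half_mul_log_one_add_inv_le hx
    have h2 : 3 / x ^ 2 ≤ 3 / r ^ 2 := by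
      have : r ≤ x := by linarith [(Nat.cast_nonneg n : (0 : ℝ) ≤ n)]
      gcongr
    have h3 : Real.log (1 + x⁻¹) = Real.log (x + 1) - Real.log x := by
      rw [← Real.log_div (by positivity) hx0.ne', add_div, div_self hx0.ne', one_div]
    rw [h3] at h1
    have e : r + ((n + 1 : ℕ) : ℝ) = x + 1 := by push_cast; ring
    rw [e, Real.Gamma_add_one hx0.ne', Real.log_mul hx0.ne' (Real.Gamma_pos_of_pos hx0).ne']
    have h4 : 3 * ((n + 1 : ℕ) : ℝ) / r ^ 2 = 3 * n / r ^ 2 + 3 / r ^ 2 := by push_cast; ring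
    rw [h4]
    nlinarith

end NegMultinomial

/-! ### Local comparison at lattice points -/

namespace NegMultinomial

variable {d : ℕ} {p : Fin d → ℝ}

lemma nmPMF_pos (hp : ∀ i, 0 < p i) (hs : ∑ i, p i < 1) {r : ℝ} (hr : 0 < r) (k : Fin d → ℕ) :
    0 < nmPMF r p k := by
  have h1 : 0 < Real.Gamma (r + ∑ i, (k i : ℝ)) := Real.Gamma_pos_of_pos (by positivity)
  have h2 : 0 < Real.Gamma r := Real.Gamma_pos_of_pos hr
  have h3 := pZero_pos hs
  have h4 : 0 < ∏ i, p i ^ k i := Finset.prod_pos fun i _ ↦ pow_pos (hp i) _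
  unfold nmPMF
  positivity

lemma log_nmPMF (hp : ∀ i, 0 < p i) (hs : ∑ i, p i < 1) {r : ℝ} (hr : 0 < r) (k : Fin d → ℕ) :
    Real.log (nmPMF r p k) =
      Real.log (Real.Gamma (r + ∑ i, (k i : ℝ))) - Real.log (Real.Gamma r) +
        r * Real.log (pZero p) + ∑ i, (k i * Real.log (p i) - Real.log (k i)!) := by
  have h1 : 0 < Real.Gamma (r + ∑ i, (k i : ℝ)) := Real.Gamma_pos_of_pos (by positivity)
  have h2 : 0 < Real.Gamma r := Real.Gamma_pos_of_pos hr
  have h3 := pZero_pos hs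
  have h4 : 0 < ∏ i, p i ^ k i := Finset.prod_pos fun i _ ↦ pow_pos (hp i) _
  have h5 : 0 < ∏ i, ((k i)! : ℝ) := Finset.prod_pos fun i _ ↦ by positivity
  rw [nmPMF, Real.log_mul (by positivity) h4.ne', Real.log_mul (by positivity) (by positivity),
    Real.log_div h1.ne' (by positivity), Real.log_mul h2.ne' h5.ne', Real.log_rpow h3,
    Real.log_prod (fun i _ ↦ by positivity), Real.log_prod (fun i _ ↦ (pow_pos (hp i) _).ne'),
    Finset.sum_sub_distrib]
  simp only [Real.log_pow]
  ring

/-- The logarithmic local comparison of the negative multinomial mass function with the normal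
density at a lattice point. -/
lemma log_gaussDensity_sub_le_log_nmPMF (hp : ∀ i, 0 < p i) (hs : ∑ i, p i < 1) {r : ℝ}
    (hr : 2 ≤ r) (k : Fin d → ℕ) (hk : ∀ i, k i ≠ 0) (t : Fin d → ℝ) (t₀ : ℝ)
    (ht : ∀ i, |t i| ≤ 1 / 2) (ht₀ : |t₀| ≤ 1 / 2)
    (hkt : ∀ i, (k i : ℝ) = r * rho p i * (1 + t i))
    (hkt₀ : r + ∑ i, (k i : ℝ) = r / pZero p * (1 + t₀)) :
    Real.log (gaussDensity (r • rho p) (r • covMatrix p) fun i ↦ k i) -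
      (4 * (r / pZero p) * |t₀| ^ 3 + ∑ i, 4 * (r * rho p i) * |t i| ^ 3 +
        (|t₀| + ∑ i, |t i|) / 2 + 3 * (∑ i, (k i : ℝ)) / r ^ 2 + ∑ i, 1 / (12 * (k i : ℝ))) ≤
      Real.log (nmPMF r p k) := by
  have hr0 : 0 < r := by linarith
  have h0 := pZero_pos hs
  have hG := le_log_Gamma_add_nat_sub hr (∑ i, k i)
  push_cast at hG
  set N : ℝ := ∑ i, (k i : ℝ) with hN
  set l : Fin d → ℝ := fun i ↦ Real.log (1 + t i) with hl
  set l₀ : ℝ := Real.log (1 + t₀) with hl₀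
  have hpos {s : ℝ} (h : |s| ≤ 1 / 2) : 0 < 1 + s := by linarith [(abs_le.1 h).1]
  have hlle {s : ℝ} (h : |s| ≤ 1 / 2) : Real.log (1 + s) ≤ |s| := by
    have := Real.log_le_sub_one_of_pos (hpos h)
    linarith [le_abs_self s]
  have hlogN : Real.log (r + N) = Real.log r - Real.log (pZero p) + l₀ := by
    rw [hkt₀, Real.log_mul (by positivity) (hpos ht₀).ne', Real.log_div hr0.ne' h0.ne']
  -- Stirling for a single kᵢ!. The last bracket is kept apart: its sum over i cancels against terms
  -- of the Gamma ratio and the linear term in t₀.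
  have hterm (i : Fin d) :
      -(Real.log (2 * Real.pi) / 2) - Real.log r / 2 - Real.log (rho p i) / 2 -
        ((k i : ℝ) - r * rho p i) ^ 2 / rho p i / (2 * r) - 4 * (r * rho p i) * |t i| ^ 3 -
        |t i| / 2 - 1 / (12 * (k i : ℝ)) +
        (k i * (Real.log (pZero p) - Real.log r) + r * rho p i) ≤
      k i * Real.log (p i) - Real.log (k i)! := by
    have hρ := rho_pos hp hs i
    have hk1 := log_factorial_le (hk i)
    have hlogρ : Real.log (rho p i) = Real.log (p i) - Real.log (pZero p) := by
      rw [rho, Real.log_div (hp i).ne' h0.ne']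
    have hlogk : Real.log (k i) = Real.log r + Real.log (rho p i) + l i := by
      rw [hkt, Real.log_mul (by positivity) (hpos (ht i)).ne', Real.log_mul hr0.ne' hρ.ne']
    have hψ := (abs_le.1 (abs_one_add_mul_log_sub_le (ht i))).2
    have hψ' := mul_le_mul_of_nonneg_left hψ (by positivity : 0 ≤ r * rho p i)
    have hq : ((k i : ℝ) - r * rho p i) ^ 2 / rho p i / (2 * r) = r * rho p i * (t i ^ 2 / 2) := by
      rw [hkt]
      field_simp
      ring
    have hli : l i ≤ |t i| := hlle (ht i)
    have hmul : (k i : ℝ) * Real.log (k i) =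
        k i * (Real.log r + Real.log (p i) - Real.log (pZero p)) +
          r * rho p i * ((1 + t i) * l i) := by
      rw [hlogk, hlogρ]
      linear_combination l i * hkt i
    rw [hq]
    rw [hmul, hlogk] at hk1
    have hkt' := hkt i
    have : r * rho p i * ((1 + t i) * l i) - r * rho p i * t i - r * rho p i * (t i ^ 2 / 2) ≤
      4 * (r * rho p i) * |t i| ^ 3 := by
        calc _ = r * rho p i * ((1 + t i) * Real.log (1 + t i) - t i - t i ^ 2 / 2) := by
              rw [hl]; ring
          _ ≤ _ := hψ'.trans_eq (by ring)
    linarith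
  have hsum := Finset.sum_le_sum fun i (_ : i ∈ Finset.univ) ↦ hterm i
  simp only [Finset.sum_add_distrib, Finset.sum_sub_distrib, Finset.sum_neg_distrib,
    Finset.sum_const, Finset.card_univ, Fintype.card_fin, nsmul_eq_mul, ← Finset.sum_div,
    ← Finset.sum_mul, ← Finset.mul_sum, ← hN] at hsum
  have hρs : ∑ i, rho p i = (pZero p)⁻¹ - 1 := by linarith [one_add_sum_rho hs]
  have hN' : N = r / pZero p * (1 + t₀) - r := by linarith
  have hψ := mul_le_mul_of_nonneg_left
    (neg_le_of_abs_le (abs_one_add_mul_log_sub_le ht₀)) (by positivity : 0 ≤ r / pZero p)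
  have hl₀' : l₀ ≤ |t₀| := hlle ht₀
  -- This identity makes the linear terms cancel and turns the rank-one part of the quadratic form
  -- into the t₀² term.
  have hdiff : ∑ i, ((k i : ℝ) - r * rho p i) = r / pZero p * t₀ := by
    rw [Finset.sum_sub_distrib, ← hN, ← Finset.mul_sum, hρs, hN']
    field_simp
    ring
  have hq₀ : pZero p * (r / pZero p * t₀) ^ 2 / (2 * r) = r / pZero p * (t₀ ^ 2 / 2) := by
    field_simp
  rw [log_gaussDensity hp hs hr0, log_nmPMF hp hs hr0, hdiff, sub_div _ _ (2 * r), hq₀]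
  rw [hlogN] at hG
  have hmul : (r + N - 1 / 2) * (Real.log r - Real.log (pZero p) + l₀) =
      (r + N - 1 / 2) * (Real.log r - Real.log (pZero p)) - l₀ / 2 +
        r / pZero p * ((1 + t₀) * l₀) := by
    linear_combination l₀ * hkt₀
  have e1 : r / pZero p * t₀ = N - r * ∑ i, rho p i := by
    rw [← hdiff, Finset.sum_sub_distrib, ← hN, Finset.mul_sum]
  have hψ' : - (4 * (r / pZero p) * |t₀| ^ 3) ≤
      r / pZero p * ((1 + t₀) * l₀) - r / pZero p * t₀ - r / pZero p * (t₀ ^ 2 / 2) := by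
    calc _ = r / pZero p * -(4 * |t₀| ^ 3) := by ring
      _ ≤ _ := hψ
      _ = _ := by rw [hl₀]; ring
  rw [hmul] at hG
  simp only [Finset.sum_sub_distrib] at hsum ⊢
  rw [← hN]
  nlinarith

end NegMultinomial

/-! ### Local comparison at arbitrary points near the mean -/

namespace NegMultinomial

variable {d : ℕ} {p : Fin d → ℝ} {b r : ℝ}

/-- The `ℓ¹`-distance of `y` to the mean `r ϱ`, plus the dimension. -/
noncomputable def meanDist (r : ℝ) (p y : Fin d → ℝ) : ℝ := d + ∑ i, |y i - r * rho p i|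

/-- The relative error of the local normal approximation. -/
noncomputable def localError (b r : ℝ) (p y : Fin d → ℝ) : ℝ :=
  8 * (meanDist r p y / (r * b ^ 2) + meanDist r p y ^ 3 / (r ^ 2 * b ^ 4))

lemma meanDist_nonneg (r : ℝ) (p y : Fin d → ℝ) : 0 ≤ meanDist r p y := by
  unfold meanDist
  positivity

lemma localError_nonneg (hr : 0 < r) (p y : Fin d → ℝ) : 0 ≤ localError b r p y := by
  have := meanDist_nonneg r p y
  unfold localError
  positivity

lemma pZero_lt_one (hd : 1 ≤ d) (hp : ∀ i, 0 < p i) : pZero p < 1 := by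
  have : 0 < ∑ i, p i := Finset.sum_pos (fun i _ ↦ hp i) ⟨⟨0, hd⟩, Finset.mem_univ _⟩
  unfold pZero
  linarith

lemma le_rho (hp : p ∈ paramSet d b) (hd : 1 ≤ d) (i : Fin d) : b ≤ rho p i := by
  obtain ⟨h1, h2, h3, h4⟩ := hp
  have h0 := pZero_pos h2
  have h0' := pZero_lt_one hd fun i ↦ (h1 i).1
  rw [rho, le_div_iff₀ h0]
  nlinarith [h4 i, (h1 i).1]

lemma inv_rho_le (hb : 0 < b) (hp : p ∈ paramSet d b) (hd : 1 ≤ d) (i : Fin d) :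
    (rho p i)⁻¹ ≤ 1 / b := by
  rw [one_div]
  exact inv_anti₀ hb (le_rho hp hd i)

lemma card_mul_le_one (hp : p ∈ paramSet d b) : d * b ≤ 1 := by
  obtain ⟨h1, h2, h3, h4⟩ := hp
  have := Finset.sum_le_sum fun i (_ : i ∈ Finset.univ) ↦ h4 i
  simp only [Finset.sum_const, Finset.card_univ, Fintype.card_fin, nsmul_eq_mul] at this
  linarith

/-- The cost of rounding y to a cube corner z: each of the two parts of the quadratic form changes
by at most 2 W / b, and the exponent divides by 2 r. -/
lemma log_gaussDensity_sub_le (hb : 0 < b) (hp : p ∈ paramSet d b) (hd : 1 ≤ d) (hr : 0 < r)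
    {y z : Fin d → ℝ} (hz : ∀ i, z i ≤ y i) (hz' : ∀ i, y i ≤ z i + 1) {W : ℝ}
    (hWy : ∑ i, |y i - r * rho p i| ≤ W) (hWz : ∑ i, |z i - r * rho p i| ≤ W) :
    Real.log (gaussDensity (r • rho p) (r • covMatrix p) y) - 2 * W / (r * b) ≤
      Real.log (gaussDensity (r • rho p) (r • covMatrix p) z) := by
  have hp0 (i : Fin d) : 0 < p i := (hp.1 i).1
  have h0 := pZero_pos hp.2.1
  have h0' := pZero_lt_one hd hp0
  have hρ (i : Fin d) := rho_pos hp0 hp.2.1 i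
  have hW : 0 ≤ W := le_trans (by positivity) hWy
  have hdb := card_mul_le_one hp
  rw [log_gaussDensity hp0 hp.2.1 hr, log_gaussDensity hp0 hp.2.1 hr]
  set Y : Fin d → ℝ := fun i ↦ y i - r * rho p i with hY
  set Z : Fin d → ℝ := fun i ↦ z i - r * rho p i with hZ
  have hsq {u v c : ℝ} (h : |u - v| ≤ c) : u ^ 2 - v ^ 2 ≤ c * (|u| + |v|) := by
    calc u ^ 2 - v ^ 2 = (u - v) * (u + v) := by ring
      _ ≤ |u - v| * |u + v| := by rw [← abs_mul]; exact le_abs_self _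
      _ ≤ c * (|u| + |v|) := by
        gcongr
        · exact (abs_nonneg _).trans h
        · exact abs_add_le u v
  have hZY (i : Fin d) : |Z i - Y i| ≤ 1 := by
    simp only [hZ, hY]
    rw [abs_le]
    constructor <;> linarith [hz i, hz' i]
  have hA : ∑ i, Z i ^ 2 / rho p i - ∑ i, Y i ^ 2 / rho p i ≤ 2 * W / b := by
    rw [← Finset.sum_sub_distrib]
    calc _ ≤ ∑ i, (1 / b) * (|Z i| + |Y i|) := by
          refine Finset.sum_le_sum fun i _ ↦ ?_
          rw [← sub_div, div_eq_inv_mul]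
          refine (mul_le_mul_of_nonneg_left (hsq (hZY i)) (inv_nonneg.2 (hρ i).le)).trans ?_
          rw [one_mul]
          exact mul_le_mul_of_nonneg_right (inv_rho_le hb hp hd i) (by positivity)
      _ = (1 / b) * (∑ i, |Z i| + ∑ i, |Y i|) := by rw [← Finset.mul_sum, Finset.sum_add_distrib]
      _ ≤ (1 / b) * (W + W) := by gcongr
      _ = _ := by ring
  have hB : pZero p * (∑ i, Y i) ^ 2 - pZero p * (∑ i, Z i) ^ 2 ≤ 2 * W / b := by
    have h1 : |∑ i, Y i - ∑ i, Z i| ≤ d := by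
      rw [← Finset.sum_sub_distrib]
      refine (Finset.abs_sum_le_sum_abs _ _).trans ?_
      refine (Finset.sum_le_sum fun i _ ↦ (abs_sub_comm _ _).trans_le (hZY i)).trans ?_
      simp
    have h2 := hsq h1
    have h3 : |∑ i, Y i| ≤ W := (Finset.abs_sum_le_sum_abs _ _).trans hWy
    have h4 : |∑ i, Z i| ≤ W := (Finset.abs_sum_le_sum_abs _ _).trans hWz
    -- Rounding can shift the coordinate sum by d, which is absorbed into the constant.
    have hd' : (d : ℝ) ≤ 1 / b := by rwa [le_div_iff₀ hb]
    calc _ = pZero p * ((∑ i, Y i) ^ 2 - (∑ i, Z i) ^ 2) := by ring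
      _ ≤ pZero p * (d * (|∑ i, Y i| + |∑ i, Z i|)) := by gcongr
      _ ≤ 1 * (1 / b * (W + W)) := by gcongr
      _ = _ := by ring
  have h2r : (∑ i, Z i ^ 2 / rho p i - pZero p * (∑ i, Z i) ^ 2) / (2 * r) -
      (∑ i, Y i ^ 2 / rho p i - pZero p * (∑ i, Y i) ^ 2) / (2 * r) ≤ 2 * W / (r * b) := by
    rw [← sub_div, div_le_iff₀ (by positivity)]
    have : 2 * W / (r * b) * (2 * r) = 2 * W / b + 2 * W / b := by field_simp; ring
    rw [this]
    linarith
  simp only [hY, hZ] at h2r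
  linarith

lemma one_le_localError (hb : 0 < b) (hp : p ∈ paramSet d b) (hd : 1 ≤ d) (hr : 0 < r)
    {y : Fin d → ℝ} (hy : r * b / 2 < meanDist r p y) : 1 ≤ localError b r p y := by
  have hW := meanDist_nonneg r p y
  have hb1 : b ≤ 1 := (hp.2.2.2 ⟨0, hd⟩).trans (hp.1 _).2.le
  have h1 : 1 / 2 ≤ meanDist r p y / (r * b ^ 2) := by
    rw [le_div_iff₀ (by positivity)]
    nlinarith [mul_pos hr hb]
  have h2 : 0 ≤ meanDist r p y ^ 3 / (r ^ 2 * b ^ 4) := by positivity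
  unfold localError
  linarith

lemma pos_of_meanDist_le (hb : 0 < b) (hp : p ∈ paramSet d b) (hd : 1 ≤ d) (hr : 0 < r)
    {y : Fin d → ℝ} (hy : meanDist r p y ≤ r * b / 2) (i : Fin d) : 0 < y i := by
  have h1 : |y i - r * rho p i| ≤ ∑ j, |y j - r * rho p j| :=
    Finset.single_le_sum (f := fun j ↦ |y j - r * rho p j|) (fun _ _ ↦ abs_nonneg _)
      (Finset.mem_univ i)
  have h2 := le_rho hp hd i
  have h3 := (abs_le.1 h1).1
  have h4 : r * b ≤ r * rho p i := by gcongr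
  have h5 : (0 : ℝ) ≤ d := by positivity
  unfold meanDist at hy
  nlinarith [mul_pos hr hb]

/-- With τ = W / (r b), cubic terms are of size (r / b) τ³ = W³ / (r² b⁴), and every other term is a
multiple of W / (r b²). The coefficients add up to 8 and to less than 8. -/
lemma remainder_le (hb : 0 < b) (hp : p ∈ paramSet d b) (hd : 1 ≤ d) (hr : 2 ≤ r)
    {W : ℝ} (hW1 : 1 ≤ W) (hτ2 : W / (r * b) ≤ 1 / 2) {k : Fin d → ℕ} {t : Fin d → ℝ} {t₀ : ℝ}
    (htτ : ∀ i, |t i| ≤ W / (r * b)) (ht₀τ : |t₀| ≤ W / (r * b))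
    (hkt₀ : r + ∑ i, (k i : ℝ) = r / pZero p * (1 + t₀)) (hkpos : ∀ i, r * b / 2 ≤ k i) :
    4 * (r / pZero p) * |t₀| ^ 3 + ∑ i, 4 * (r * rho p i) * |t i| ^ 3 +
      (|t₀| + ∑ i, |t i|) / 2 + 3 * (∑ i, (k i : ℝ)) / r ^ 2 + ∑ i, 1 / (12 * (k i : ℝ)) +
      2 * W / (r * b) ≤ 8 * (W / (r * b ^ 2) + W ^ 3 / (r ^ 2 * b ^ 4)) := by
  have hr0 : 0 < r := by linarith
  have hp0 (i : Fin d) : 0 < p i := (hp.1 i).1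
  have hs := hp.2.1
  have h0 := pZero_pos hs
  have hbp := hp.2.2.1
  have hρ (i : Fin d) := rho_pos hp0 hs i
  have hdb := card_mul_le_one hp
  have hb1 : b ≤ 1 := (hp.2.2.2 ⟨0, hd⟩).trans (hp.1 _).2.le
  have hρs : ∑ i, rho p i = (pZero p)⁻¹ - 1 := by linarith [one_add_sum_rho hs]
  set τ := W / (r * b) with hτ
  have hτ0 : 0 ≤ τ := by positivity
  have hinv0 : (pZero p)⁻¹ ≤ 1 / b := by rw [one_div]; exact inv_anti₀ hb hbp
  have hd' : (d : ℝ) ≤ 1 / b := by rwa [le_div_iff₀ hb]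
  set A := W / (r * b ^ 2) with hA
  set B := W ^ 3 / (r ^ 2 * b ^ 4) with hB
  have hrτ : r / b * τ ^ 3 = B := by
    rw [hτ, hB]
    field_simp
  have hτA : τ = A * b := by rw [hτ, hA]; field_simp
  have hA0 : 0 ≤ A := by positivity
  have hτA' : τ ≤ A := by rw [hτA]; nlinarith
  have hrA : 1 / (r * b ^ 2) ≤ A := by rw [hA]; gcongr
  have b1 : 4 * (r / pZero p) * |t₀| ^ 3 ≤ 4 * B := by
    rw [← hrτ]
    calc _ ≤ 4 * (r / b) * τ ^ 3 := by gcongr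
      _ = _ := by ring
  have b2 : ∑ i, 4 * (r * rho p i) * |t i| ^ 3 ≤ 4 * B := by
    calc _ ≤ ∑ i, 4 * (r * rho p i) * τ ^ 3 := by
          gcongr with i
          · exact mul_nonneg (by norm_num) (mul_pos hr0 (hρ i)).le
          · exact htτ i
      _ = 4 * (r * ∑ i, rho p i) * τ ^ 3 := by
          rw [← Finset.sum_mul, ← Finset.mul_sum, ← Finset.mul_sum]
      _ ≤ 4 * (r * (1 / b)) * τ ^ 3 := by gcongr; linarith
      _ = 4 * (r / b * τ ^ 3) := by ring
      _ = _ := by rw [hrτ]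
  have b3 : (|t₀| + ∑ i, |t i|) / 2 ≤ A := by
    have h1 : ∑ i, |t i| ≤ d * τ := by
      refine (Finset.sum_le_sum fun i _ ↦ htτ i).trans ?_
      simp
    have h2 : d * τ ≤ A := by
      rw [hτA]
      nlinarith
    linarith
  have b4 : 3 * (∑ i, (k i : ℝ)) / r ^ 2 ≤ 9 / 2 * A := by
    have h1 : ∑ i, (k i : ℝ) ≤ 3 / 2 * (r * (1 / b)) := by
      have h2 : r / pZero p ≤ r * (1 / b) := by rw [div_eq_mul_inv]; gcongr
      have h3 : 1 + t₀ ≤ 3 / 2 := by linarith [(abs_le.1 ht₀τ).2]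
      have h4 : r / pZero p * (1 + t₀) ≤ r * (1 / b) * (3 / 2) := by
        gcongr
        linarith [(abs_le.1 ht₀τ).1]
      linarith
    calc _ ≤ 3 * (3 / 2 * (r * (1 / b))) / r ^ 2 := by gcongr
      _ = 9 / 2 * (b * (1 / (r * b ^ 2))) := by field_simp; ring
      _ ≤ 9 / 2 * (1 * A) := by gcongr
      _ = _ := by ring
  have b5 : ∑ i, 1 / (12 * (k i : ℝ)) ≤ 1 / 6 * A := by
    calc _ ≤ ∑ _i : Fin d, 1 / (12 * (r * b / 2)) := by
          gcongr with i
          exact hkpos i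
      _ = d * (1 / (12 * (r * b / 2))) := by simp
      _ ≤ (1 / b) * (1 / (12 * (r * b / 2))) := by gcongr
      _ = 1 / 6 * (1 / (r * b ^ 2)) := by field_simp; norm_num
      _ ≤ _ := by gcongr
  have b6 : 2 * W / (r * b) ≤ 2 * A := by
    calc _ = 2 * τ := by rw [hτ]; ring
      _ ≤ _ := by gcongr
  linarith

/-- In the bulk, the negative multinomial mass at the integer part of `y` is bounded below by the
normal density at `y`, up to a small relative error. -/
lemma gaussDensity_mul_one_sub_le (hb : 0 < b) (hp : p ∈ paramSet d b) (hd : 1 ≤ d) (hr : 2 ≤ r)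
    {y : Fin d → ℝ} (hy : meanDist r p y ≤ r * b / 2) :
    gaussDensity (r • rho p) (r • covMatrix p) y * (1 - localError b r p y) ≤
      nmPMF r p fun i ↦ ⌊y i⌋₊ := by
  have hr0 : 0 < r := by linarith
  have hp0 (i : Fin d) : 0 < p i := (hp.1 i).1
  have hs := hp.2.1
  have h0 := pZero_pos hs
  have h0' := pZero_lt_one hd hp0
  have hbp := hp.2.2.1
  have hρ (i : Fin d) := rho_pos hp0 hs i
  have hρb (i : Fin d) := le_rho hp hd i
  have hdb := card_mul_le_one hp
  have hb1 : b ≤ 1 := (hp.2.2.2 ⟨0, hd⟩).trans (hp.1 _).2.le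
  have hy0 (i : Fin d) := pos_of_meanDist_le hb hp hd hr0 hy i
  set W := meanDist r p y with hW
  have hW1 : 1 ≤ W := by
    have h1 : (1 : ℝ) ≤ d := by exact_mod_cast hd
    have h2 : 0 ≤ ∑ i, |y i - r * rho p i| := by positivity
    rw [hW, meanDist]
    linarith
  set k : Fin d → ℕ := fun i ↦ ⌊y i⌋₊ with hk
  have hky (i : Fin d) : (k i : ℝ) ≤ y i := Nat.floor_le (hy0 i).le
  have hky' (i : Fin d) : y i ≤ k i + 1 := (Nat.lt_floor_add_one (y i)).le
  have hWy : ∑ i, |y i - r * rho p i| ≤ W := by rw [hW, meanDist]; simp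
  have hWk : ∑ i, |(k i : ℝ) - r * rho p i| ≤ W := by
    have : ∑ i, |(k i : ℝ) - r * rho p i| ≤ ∑ i, (1 + |y i - r * rho p i|) := by
      refine Finset.sum_le_sum fun i _ ↦ ?_
      have h1 : |(k i : ℝ) - y i| ≤ 1 := by rw [abs_le]; constructor <;> linarith [hky i, hky' i]
      calc _ = |((k i : ℝ) - y i) + (y i - r * rho p i)| := by ring_nf
        _ ≤ _ := (abs_add_le _ _).trans (by gcongr)
    simpa [Finset.sum_add_distrib, hW, meanDist] using this
  have hki (i : Fin d) : |(k i : ℝ) - r * rho p i| ≤ W :=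
    (Finset.single_le_sum (f := fun j ↦ |(k j : ℝ) - r * rho p j|) (fun _ _ ↦ abs_nonneg _)
      (Finset.mem_univ i)).trans hWk
  -- A common bound for all relative deviations, since r ϱᵢ ≥ r b and r / p₀ ≥ r b.
  set τ := W / (r * b) with hτ
  have hτ2 : τ ≤ 1 / 2 := by
    rw [hτ, div_le_iff₀ (by positivity)]
    linarith
  have hτ0 : 0 ≤ τ := by positivity
  set t : Fin d → ℝ := fun i ↦ ((k i : ℝ) - r * rho p i) / (r * rho p i) with ht
  set t₀ : ℝ := pZero p * (∑ i, ((k i : ℝ) - r * rho p i)) / r with ht₀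
  have htτ (i : Fin d) : |t i| ≤ τ := by
    have h1 : 0 < r * rho p i := mul_pos hr0 (hρ i)
    rw [ht]
    simp only
    rw [abs_div, abs_of_pos h1]
    exact div_le_div₀ (by linarith) (hki i) (by positivity) (by gcongr; exact hρb i)
  have ht₀τ : |t₀| ≤ τ := by
    have h1 : |∑ i, ((k i : ℝ) - r * rho p i)| ≤ W :=
      (Finset.abs_sum_le_sum_abs _ _).trans hWk
    rw [ht₀, abs_div, abs_mul, abs_of_pos h0, abs_of_pos hr0]
    refine div_le_div₀ (by linarith) ?_ (by positivity) (by nlinarith)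
    calc _ ≤ 1 * W := by gcongr
      _ = W := one_mul W
  have hkt (i : Fin d) : (k i : ℝ) = r * rho p i * (1 + t i) := by
    have h1 : 0 < r * rho p i := mul_pos hr0 (hρ i)
    have h2 : r * rho p i * t i = k i - r * rho p i := mul_div_cancel₀ _ h1.ne'
    linarith
  have hρs : ∑ i, rho p i = (pZero p)⁻¹ - 1 := by linarith [one_add_sum_rho hs]
  have hkt₀ : r + ∑ i, (k i : ℝ) = r / pZero p * (1 + t₀) := by
    rw [ht₀, Finset.sum_sub_distrib, ← Finset.mul_sum, hρs]
    field_simp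
    ring
  have hkpos (i : Fin d) : r * b / 2 ≤ k i := by
    have h1 := (abs_le.1 (htτ i)).1
    rw [hkt]
    have : r * b ≤ r * rho p i := by gcongr; exact hρb i
    nlinarith [mul_pos hr0 (hρ i)]
  have hk0 (i : Fin d) : k i ≠ 0 := by
    intro h
    have := hkpos i
    rw [h, Nat.cast_zero] at this
    nlinarith [mul_pos hr0 hb]
  have main := log_gaussDensity_sub_le_log_nmPMF hp0 hs hr k hk0 t t₀
    (fun i ↦ (htτ i).trans hτ2) (ht₀τ.trans hτ2) hkt hkt₀
  have hcmp := log_gaussDensity_sub_le hb hp hd hr0 hky hky' hWy hWk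
  have hrem := remainder_le hb hp hd hr hW1 hτ2 htτ ht₀τ hkt₀ hkpos
  have hε : localError b r p y = 8 * (W / (r * b ^ 2) + W ^ 3 / (r ^ 2 * b ^ 4)) := rfl
  have hg := gaussDensity_pos hp0 hs hr0 y
  have hP := nmPMF_pos hp0 hs hr0 k
  have hlog : Real.log (gaussDensity (r • rho p) (r • covMatrix p) y) - localError b r p y ≤
      Real.log (nmPMF r p k) := by
    linarith
  calc _ ≤ gaussDensity (r • rho p) (r • covMatrix p) y * Real.exp (-localError b r p y) := by
        gcongr
        exact Real.one_sub_le_exp_neg _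
    _ = Real.exp (Real.log (gaussDensity (r • rho p) (r • covMatrix p) y) -
          localError b r p y) := by
        rw [sub_eq_add_neg, Real.exp_add, Real.exp_log hg]
    _ ≤ Real.exp (Real.log (nmPMF r p k)) := Real.exp_le_exp.2 hlog
    _ = _ := Real.exp_log hP

end NegMultinomial

/-! ### Mean of the local error under the normal law -/

namespace NegMultinomial

section Moments

/-- The absolute moments of the standard normal law. -/
noncomputable def absMoment (n : ℕ) : ℝ := ∫ x, |x| ^ n ∂(gaussianReal 0 1)

lemma absMoment_nonneg (n : ℕ) : 0 ≤ absMoment n := integral_nonneg fun _ ↦ by positivity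

lemma integrable_abs_pow_stdGaussian (n : ℕ) :
    Integrable (fun x ↦ |x| ^ n) (gaussianReal 0 1) := by
  rcases Nat.eq_zero_or_pos n with rfl | hn
  · simp
  · have h := memLp_id_gaussianReal (μ := 0) (v := 1) n
    have := h.integrable_norm_pow (by exact_mod_cast hn.ne')
    simpa using this

lemma gaussianReal_eq_map (m : ℝ) (v : NNReal) :
    gaussianReal m v = (gaussianReal 0 1).map fun x ↦ √v * x + m := by
  have h : (fun x : ℝ ↦ √v * x + m) = (fun x ↦ x + m) ∘ fun x ↦ √v * x := rfl
  rw [h, ← Measure.map_map (by fun_prop) (by fun_prop), gaussianReal_map_const_mul,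
    gaussianReal_map_add_const]
  congr 1
  · simp
  · ext
    simp

lemma integrable_abs_sub_pow_gaussianReal (m : ℝ) (v : NNReal) (n : ℕ) :
    Integrable (fun x ↦ |x - m| ^ n) (gaussianReal m v) := by
  rw [gaussianReal_eq_map, integrable_map_measure (by fun_prop) (by fun_prop)]
  simp only [Function.comp_def, add_sub_cancel_right, abs_mul, mul_pow]
  exact (integrable_abs_pow_stdGaussian n).const_mul _

lemma integral_abs_sub_pow_gaussianReal (m : ℝ) (v : NNReal) (n : ℕ) :
    ∫ x, |x - m| ^ n ∂(gaussianReal m v) = √v ^ n * absMoment n := by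
  rw [gaussianReal_eq_map, integral_map (by fun_prop) (by fun_prop)]
  simp only [add_sub_cancel_right, abs_mul, mul_pow, abs_of_nonneg (Real.sqrt_nonneg _)]
  rw [integral_const_mul, absMoment]

variable {d : ℕ} {p : Fin d → ℝ} {b r : ℝ}

/-- The normal law `N_d(r ϱ, r Σ)`. -/
noncomputable abbrev gaussLaw (r : ℝ) (p : Fin d → ℝ) : Measure (EuclideanSpace ℝ (Fin d)) :=
  multivariateGaussian (WithLp.toLp 2 (r • rho p)) (r • covMatrix p)

lemma measurePreserving_eval_gaussLaw (hp : ∀ i, 0 < p i) (hs : ∑ i, p i < 1) (hr : 0 < r)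
    (i : Fin d) : MeasurePreserving (fun x : EuclideanSpace ℝ (Fin d) ↦ x i) (gaussLaw r p)
      (gaussianReal (r * rho p i) (r * (rho p i + rho p i ^ 2)).toNNReal) := by
  have h := measurePreserving_eval_multivariateGaussian (μ := WithLp.toLp 2 (r • rho p))
    (((posDef_covMatrix hp hs).smul hr).posSemidef) (i := i)
  have e : (r • covMatrix p) i i = r * (rho p i + rho p i ^ 2) := by
    simp [covMatrix, Matrix.vecMulVec_apply, sq]
  rwa [e] at h

lemma integrable_abs_pow_gaussLaw (hp : ∀ i, 0 < p i) (hs : ∑ i, p i < 1) (hr : 0 < r)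
    (i : Fin d) (n : ℕ) : Integrable (fun x ↦ |x i - r * rho p i| ^ n) (gaussLaw r p) :=
  (measurePreserving_eval_gaussLaw hp hs hr i).integrable_comp_of_integrable
    (integrable_abs_sub_pow_gaussianReal (r * rho p i) _ n)

lemma integral_abs_pow_gaussLaw_le (hb : 0 < b) (hp : p ∈ paramSet d b) (hr : 0 < r)
    (i : Fin d) (n : ℕ) :
    ∫ x, |x i - r * rho p i| ^ n ∂(gaussLaw r p) ≤ (2 * √r / b) ^ n * absMoment n := by
  have hp0 (i : Fin d) : 0 < p i := (hp.1 i).1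
  have hρ := rho_pos hp0 hp.2.1 i
  have hM := measurePreserving_eval_gaussLaw hp0 hp.2.1 hr i
  have e : ∫ x, |x i - r * rho p i| ^ n ∂(gaussLaw r p) =
      ∫ z, |z - r * rho p i| ^ n ∂(gaussianReal (r * rho p i)
        (r * (rho p i + rho p i ^ 2)).toNNReal) := by
    rw [← hM.map_eq, integral_map hM.measurable.aemeasurable (by fun_prop)]
  rw [e, integral_abs_sub_pow_gaussianReal, Real.coe_toNNReal _ (by positivity)]
  have hb1 : b ≤ 1 := (hp.2.2.2 i).trans (hp.1 i).2.le
  have hρb : rho p i ≤ 1 / b :=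
    div_le_div₀ zero_le_one (hp.1 i).2.le hb hp.2.2.1
  have h1b : 1 ≤ 1 / b := by rwa [le_div_iff₀ hb, one_mul]
  have hv : √(r * (rho p i + rho p i ^ 2)) ≤ 2 * √r / b := by
    refine Real.sqrt_le_iff.2 ⟨by positivity, ?_⟩
    have : (2 * √r / b) ^ 2 = r * (4 * (1 / b) ^ 2) := by
      rw [div_pow, mul_pow, Real.sq_sqrt hr.le]
      ring
    rw [this]
    gcongr
    nlinarith
  gcongr
  exact absMoment_nonneg n

/-- The power mean inequality reduces W³ to one-dimensional third moments at the price of d². -/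
lemma localError_le (hr : 0 < r) (y : Fin d → ℝ) :
    localError b r p y ≤ 8 * ((∑ i, (1 + |y i - r * rho p i| ^ 1)) / (r * b ^ 2) +
      4 * d ^ 2 * (∑ i, (1 + |y i - r * rho p i| ^ 3)) / (r ^ 2 * b ^ 4)) := by
  have hW : meanDist r p y = ∑ i, (1 + |y i - r * rho p i|) := by
    simp [meanDist, Finset.sum_add_distrib]
  have h3 : meanDist r p y ^ 3 ≤ 4 * d ^ 2 * ∑ i, (1 + |y i - r * rho p i| ^ 3) := by
    have h := pow_sum_le_card_mul_sum_pow (s := Finset.univ)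
      (f := fun i ↦ 1 + |y i - r * rho p i|) (fun i _ ↦ by positivity) 2
    rw [hW]
    refine h.trans ?_
    rw [Finset.card_univ, Fintype.card_fin, mul_comm (4 : ℝ), mul_assoc]
    gcongr
    rw [Finset.mul_sum]
    gcongr with i
    have ha := abs_nonneg (y i - r * rho p i)
    set a := |y i - r * rho p i|
    -- Three times this product is the gap in (1 + a)³ ≤ 4 (1 + a³).
    have h4 : 0 ≤ (1 + a) * (a - 1) ^ 2 := by positivity
    have h5 : (1 + a) ^ (2 + 1) = 4 * (1 + a ^ 3) - 3 * ((1 + a) * (a - 1) ^ 2) := by ring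
    linarith
  unfold localError
  simp only [pow_one]
  rw [← hW]
  gcongr

/-- The constant, depending on `b` only, in the bound of the mean local error. -/
noncomputable def errorConst (b : ℝ) : ℝ :=
  8 * ((1 + 2 / b * absMoment 1) / b ^ 2 + 4 * (1 + (2 / b) ^ 3 * absMoment 3) / b ^ 6)

lemma errorConst_nonneg (hb : 0 < b) : 0 ≤ errorConst b := by
  have := absMoment_nonneg 1
  have := absMoment_nonneg 3
  unfold errorConst
  positivity

lemma integrable_one_add_abs_pow (hp : ∀ i, 0 < p i) (hs : ∑ i, p i < 1) (hr : 0 < r) (n : ℕ)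
    (i : Fin d) : Integrable (fun x ↦ 1 + |x i - r * rho p i| ^ n) (gaussLaw r p) :=
  (integrable_const 1).add (integrable_abs_pow_gaussLaw hp hs hr i n)

lemma integral_sum_one_add_abs_pow_le (hb : 0 < b) (hp : p ∈ paramSet d b) (hr : 1 ≤ r) (n : ℕ) :
    ∫ x, ∑ i, (1 + |x i - r * rho p i| ^ n) ∂(gaussLaw r p) ≤
      d * (√r ^ n * (1 + (2 / b) ^ n * absMoment n)) := by
  have hr0 : 0 < r := by linarith
  have hp0 (i : Fin d) : 0 < p i := (hp.1 i).1
  have hsr : 1 ≤ √r := Real.one_le_sqrt.2 hr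
  rw [integral_finsetSum _ fun i _ ↦ integrable_one_add_abs_pow hp0 hp.2.1 hr0 n i]
  have hc : d * (√r ^ n * (1 + (2 / b) ^ n * absMoment n)) =
      ∑ _i : Fin d, √r ^ n * (1 + (2 / b) ^ n * absMoment n) := by simp
  rw [hc]
  refine Finset.sum_le_sum fun i _ ↦ ?_
  rw [integral_add (integrable_const 1) (integrable_abs_pow_gaussLaw hp0 hp.2.1 hr0 i n)]
  have h1 := integral_abs_pow_gaussLaw_le hb hp hr0 i n
  have h2 : 1 ≤ √r ^ n := one_le_pow₀ hsr
  have h3 : (2 * √r / b) ^ n * absMoment n = √r ^ n * ((2 / b) ^ n * absMoment n) := by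
    rw [← mul_assoc, ← mul_pow]
    ring
  rw [h3] at h1
  simp only [integral_const, probReal_univ, smul_eq_mul, mul_one]
  linarith

/-- The factor d² of the cubic term is replaced by 1 / b², which leaves one factor d and turns b⁴
into b⁶. -/
lemma errorConst_bound (hb : 0 < b) (hdb : d * b ≤ 1) (hr : 0 < r) {I₁ I₃ : ℝ}
    (h1 : I₁ ≤ d * (√r ^ 1 * (1 + (2 / b) ^ 1 * absMoment 1)))
    (h3 : I₃ ≤ d * (√r ^ 3 * (1 + (2 / b) ^ 3 * absMoment 3))) :
    8 * (I₁ / (r * b ^ 2) + 4 * d ^ 2 * I₃ / (r ^ 2 * b ^ 4)) ≤ errorConst b * d / √r := by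
  have hM3 := absMoment_nonneg 3
  have hd : (d : ℝ) ≤ 1 / b := by rwa [le_div_iff₀ hb]
  obtain ⟨s, hs0, rfl⟩ : ∃ s : ℝ, 0 < s ∧ r = s ^ 2 :=
    ⟨√r, by positivity, (Real.sq_sqrt hr.le).symm⟩
  rw [Real.sqrt_sq hs0.le] at h1 h3 ⊢
  calc _ ≤ 8 * (d * (s ^ 1 * (1 + (2 / b) ^ 1 * absMoment 1)) / (s ^ 2 * b ^ 2) +
        4 * d ^ 2 * (d * (s ^ 3 * (1 + (2 / b) ^ 3 * absMoment 3))) / ((s ^ 2) ^ 2 * b ^ 4)) := by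
        gcongr
    _ ≤ 8 * (d * (s ^ 1 * (1 + (2 / b) ^ 1 * absMoment 1)) / (s ^ 2 * b ^ 2) +
        4 * (1 / b) ^ 2 * (d * (s ^ 3 * (1 + (2 / b) ^ 3 * absMoment 3))) /
          ((s ^ 2) ^ 2 * b ^ 4)) := by
        gcongr
    _ = _ := by
        rw [errorConst]
        field_simp

lemma lintegral_ofReal_le_of_le_add {Ω : Type*} [MeasurableSpace Ω] {μ : Measure Ω}
    {f g₁ g₂ : Ω → ℝ} (h₁ : Integrable g₁ μ) (h₂ : Integrable g₂ μ) (hg₁ : ∀ x, 0 ≤ g₁ x)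
    (hg₂ : ∀ x, 0 ≤ g₂ x) {a c e u : ℝ} (ha : 0 ≤ a) (hc : 0 ≤ c) (he : 0 ≤ e) (hu : 0 ≤ u)
    (hf : ∀ x, f x ≤ a * (g₁ x / c + e * g₂ x / u)) :
    ∫⁻ x, ENNReal.ofReal (f x) ∂μ ≤
      ENNReal.ofReal (a * ((∫ x, g₁ x ∂μ) / c + e * (∫ x, g₂ x ∂μ) / u)) := by
  have h₁' := h₁.div_const c
  have h₂' := (h₂.const_mul e).div_const u
  refine (lintegral_mono fun x ↦ ENNReal.ofReal_le_ofReal (hf x)).trans ?_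
  have h : Integrable (fun x ↦ a * (g₁ x / c + e * g₂ x / u)) μ := (h₁'.add h₂').const_mul a
  rw [← ofReal_integral_eq_lintegral_ofReal h
    (ae_of_all _ fun x ↦ mul_nonneg ha (add_nonneg (div_nonneg (hg₁ x) hc)
      (div_nonneg (mul_nonneg he (hg₂ x)) hu)))]
  rw [integral_const_mul, integral_add h₁' h₂', integral_div, integral_div, integral_const_mul]

lemma lintegral_localError_le (hb : 0 < b) (hp : p ∈ paramSet d b) (hr : 1 ≤ r) :
    ∫⁻ x, ENNReal.ofReal (localError b r p x.ofLp) ∂(gaussLaw r p) ≤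
      ENNReal.ofReal (errorConst b * d / √r) := by
  have hr0 : 0 < r := by linarith
  have hS (n : ℕ) : Integrable (fun x ↦ ∑ i, (1 + |x i - r * rho p i| ^ n)) (gaussLaw r p) :=
    integrable_finsetSum _ fun i _ ↦
      integrable_one_add_abs_pow (fun i ↦ (hp.1 i).1) hp.2.1 hr0 n i
  have hnn (n : ℕ) (x : EuclideanSpace ℝ (Fin d)) : 0 ≤ ∑ i, (1 + |x i - r * rho p i| ^ n) := by
    positivity
  refine (lintegral_ofReal_le_of_le_add (hS 1) (hS 3) (hnn 1) (hnn 3) (by norm_num)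
    (by positivity) (by positivity) (by positivity) fun x ↦ localError_le hr0 x.ofLp).trans ?_
  exact ENNReal.ofReal_le_ofReal (errorConst_bound hb (card_mul_le_one hp) hr0
    (integral_sum_one_add_abs_pow_le hb hp hr 1) (integral_sum_one_add_abs_pow_le hb hp hr 3))

end Moments

end NegMultinomial

/-! ### The two Markov kernels and the final bound -/

namespace NegMultinomial

section Kernels

variable {d : ℕ} {p : Fin d → ℝ} {b r : ℝ}

/-- The half-open unit cube with lower corner `k`. -/
def unitCube (k : Fin d → ℕ) : Set (Fin d → ℝ) := Set.univ.pi fun i ↦ Set.Ico (k i : ℝ) (k i + 1)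

lemma measurableSet_unitCube (k : Fin d → ℕ) : MeasurableSet (unitCube k) :=
  MeasurableSet.univ_pi fun _ ↦ measurableSet_Ico

lemma volume_unitCube (k : Fin d → ℕ) : volume (unitCube k) = 1 := by
  simp [unitCube, Real.volume_pi_Ico]

lemma mem_unitCube_floor {y : Fin d → ℝ} (hy : ∀ i, 0 ≤ y i) : y ∈ unitCube fun i ↦ ⌊y i⌋₊ :=
  fun i _ ↦ ⟨Nat.floor_le (hy i), Nat.lt_floor_add_one _⟩

lemma floor_eq_of_mem_unitCube {k : Fin d → ℕ} {y : Fin d → ℝ} (hy : y ∈ unitCube k) :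
    (fun i ↦ ⌊y i⌋₊) = k := by
  ext i
  have h := hy i trivial
  exact (Nat.floor_eq_iff ((Nat.cast_nonneg _).trans h.1)).2 h

/-- The kernel that sends `k` to the uniform law on the unit cube with lower corner `k`. -/
noncomputable def cubeKernel (d : ℕ) : Kernel (Fin d → ℕ) (EuclideanSpace ℝ (Fin d)) :=
  Kernel.ofFunOfCountable fun k ↦ (volume.restrict (unitCube k)).map (WithLp.toLp 2)

lemma cubeKernel_apply (k : Fin d → ℕ) {A : Set (EuclideanSpace ℝ (Fin d))}
    (hA : MeasurableSet A) :
    cubeKernel d k A = volume (WithLp.toLp 2 ⁻¹' A ∩ unitCube k) := by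
  have hm : Measurable (WithLp.toLp 2 : (Fin d → ℝ) → EuclideanSpace ℝ (Fin d)) := by fun_prop
  change ((volume.restrict (unitCube k)).map (WithLp.toLp 2)) A = _
  rw [Measure.map_apply hm hA, Measure.restrict_apply (hm hA)]

instance : IsMarkovKernel (cubeKernel d) where
  isProbabilityMeasure k := ⟨by
    rw [cubeKernel_apply k MeasurableSet.univ, Set.preimage_univ, Set.univ_inter, volume_unitCube]⟩

lemma cubeKernel_comp_nmMeasure_apply {A : Set (EuclideanSpace ℝ (Fin d))}
    (hA : MeasurableSet A) :
    (cubeKernel d ∘ₘ nmMeasure r p) A =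
      ∑' k, ENNReal.ofReal (nmPMF r p k) * volume (WithLp.toLp 2 ⁻¹' A ∩ unitCube k) := by
  rw [Measure.bind_apply hA (Kernel.aemeasurable _), nmMeasure, lintegral_sum_measure]
  simp only [lintegral_smul_measure, lintegral_dirac, smul_eq_mul, cubeKernel_apply _ hA]

/-- Coordinatewise integer part. -/
noncomputable def floorMap (d : ℕ) (x : EuclideanSpace ℝ (Fin d)) : Fin d → ℕ := fun i ↦ ⌊x i⌋₊

lemma measurable_floorMap : Measurable (floorMap d) :=
  measurable_pi_lambda _ fun i ↦ Nat.measurable_floor.comp (by fun_prop)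

/-- Integer parts invert the smoothing exactly, so the estimate for one direction also serves the
other. -/
lemma cubeKernel_comp_nmMeasure_preimage_floorMap {B : Set (Fin d → ℕ)} :
    (cubeKernel d ∘ₘ nmMeasure r p) (floorMap d ⁻¹' B) = nmMeasure r p B := by
  have hB : MeasurableSet B := B.to_countable.measurableSet
  rw [cubeKernel_comp_nmMeasure_apply (measurable_floorMap hB), nmMeasure, Measure.sum_apply _ hB]
  refine tsum_congr fun k ↦ ?_
  rw [Measure.smul_apply, Measure.dirac_apply' _ hB, smul_eq_mul]
  congr 1
  have hfl {y : Fin d → ℝ} (hy : y ∈ unitCube k) : floorMap d (WithLp.toLp 2 y) = k :=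
    floor_eq_of_mem_unitCube hy
  by_cases hk : k ∈ B
  · have e : WithLp.toLp 2 ⁻¹' (floorMap d ⁻¹' B) ∩ unitCube k = unitCube k :=
      Set.inter_eq_right.2 fun y hy ↦ by
        rw [Set.mem_preimage, Set.mem_preimage, hfl hy]
        exact hk
    rw [e, volume_unitCube, Set.indicator_of_mem hk, Pi.one_apply]
  · have e : WithLp.toLp 2 ⁻¹' (floorMap d ⁻¹' B) ∩ unitCube k = ∅ := by
      refine Set.eq_empty_of_forall_notMem fun y hy ↦ hk ?_
      have := hy.1
      rwa [Set.mem_preimage, Set.mem_preimage, hfl hy.2] at this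
    rw [e, measure_empty, Set.indicator_of_notMem hk]

lemma ofReal_gaussDensity_le (hb : 0 < b) (hp : p ∈ paramSet d b) (hd : 1 ≤ d) (hr : 2 ≤ r)
    (y : Fin d → ℝ) :
    ENNReal.ofReal (gaussDensity (r • rho p) (r • covMatrix p) y) ≤
      ∑' k, (unitCube k).indicator (fun _ ↦ ENNReal.ofReal (nmPMF r p k)) y +
        ENNReal.ofReal (localError b r p y) *
          ENNReal.ofReal (gaussDensity (r • rho p) (r • covMatrix p) y) := by
  have hr0 : 0 < r := by linarith
  have hg := gaussDensity_pos (fun i ↦ (hp.1 i).1) hp.2.1 hr0 y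
  have hε := localError_nonneg (b := b) hr0 p y
  rw [← ENNReal.ofReal_mul hε]
  rcases le_or_gt (meanDist r p y) (r * b / 2) with h | h
  · have hy := pos_of_meanDist_le hb hp hd hr0 h
    have h1 := gaussDensity_mul_one_sub_le hb hp hd hr h
    have h2 := ENNReal.le_tsum (f := fun k ↦
      (unitCube k).indicator (fun _ ↦ ENNReal.ofReal (nmPMF r p k)) y) fun i ↦ ⌊y i⌋₊
    rw [Set.indicator_of_mem (mem_unitCube_floor fun i ↦ (hy i).le)] at h2
    refine le_trans ?_ (add_le_add_left h2 _)
    rw [← ENNReal.ofReal_add (nmPMF_pos (fun i ↦ (hp.1 i).1) hp.2.1 hr0 _).le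
      (mul_nonneg hε hg.le)]
    exact ENNReal.ofReal_le_ofReal (by linarith)
  -- Outside the bulk the error term alone dominates the density.
  · have h1 := one_le_localError hb hp hd hr0 h
    exact le_add_left (ENNReal.ofReal_le_ofReal (le_mul_of_one_le_left hg.le h1))

lemma measurable_localError : Measurable (localError b r p) := by
  unfold localError meanDist
  fun_prop

lemma gaussLaw_le_add (hb : 0 < b) (hp : p ∈ paramSet d b) (hd : 1 ≤ d) (hr : 2 ≤ r)
    {A : Set (EuclideanSpace ℝ (Fin d))} (hA : MeasurableSet A) :
    gaussLaw r p A ≤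
      (cubeKernel d ∘ₘ nmMeasure r p) A + ENNReal.ofReal (errorConst b * d / √r) := by
  have hr0 : 0 < r := by linarith
  have hS : (r • covMatrix p).PosDef :=
    (posDef_covMatrix (fun i ↦ (hp.1 i).1) hp.2.1).smul hr0
  have hm : Measurable (WithLp.toLp 2 : (Fin d → ℝ) → EuclideanSpace ℝ (Fin d)) := by fun_prop
  set A' : Set (Fin d → ℝ) := WithLp.toLp 2 ⁻¹' A with hA'
  have hA'm : MeasurableSet A' := hm hA
  have hgm := measurable_gaussDensity (r • rho p) (r • covMatrix p)
  have hεm := measurable_localError (b := b) (r := r) (p := p)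
  have hofLp : Measurable (WithLp.ofLp : EuclideanSpace ℝ (Fin d) → Fin d → ℝ) := by fun_prop
  set g : (Fin d → ℝ) → ℝ≥0∞ :=
    fun y ↦ ENNReal.ofReal (gaussDensity (r • rho p) (r • covMatrix p) y) with hg
  set ε : (Fin d → ℝ) → ℝ≥0∞ := fun y ↦ ENNReal.ofReal (localError b r p y) with hε
  have hεm' : Measurable ε := hεm.ennreal_ofReal
  have h1 : gaussLaw r p A = ∫⁻ y in A', g y := by
    rw [← lintegral_indicator_one hA, lintegral_multivariateGaussian _ hS
      (measurable_one.indicator hA), ← lintegral_indicator hA'm]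
    refine lintegral_congr fun y ↦ ?_
    by_cases hy : WithLp.toLp 2 y ∈ A
    · rw [Set.indicator_of_mem hy, Set.indicator_of_mem (show y ∈ A' from hy), Pi.one_apply,
        one_mul]
    · rw [Set.indicator_of_notMem hy, Set.indicator_of_notMem (show y ∉ A' from hy), zero_mul]
  have h2 : ∫⁻ y, ε y * g y = ∫⁻ x, ε x.ofLp ∂(gaussLaw r p) :=
    (lintegral_multivariateGaussian _ hS (hεm'.comp hofLp)).symm
  have hcm (k : Fin d → ℕ) :
      Measurable ((unitCube k).indicator fun _ : Fin d → ℝ ↦ ENNReal.ofReal (nmPMF r p k)) :=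
    measurable_const.indicator (measurableSet_unitCube k)
  have h3 : ∫⁻ y in A', ∑' k, (unitCube k).indicator (fun _ ↦ ENNReal.ofReal (nmPMF r p k)) y =
      (cubeKernel d ∘ₘ nmMeasure r p) A := by
    rw [lintegral_tsum fun k ↦ (hcm k).aemeasurable, cubeKernel_comp_nmMeasure_apply hA]
    refine tsum_congr fun k ↦ ?_
    rw [lintegral_indicator_const (measurableSet_unitCube k),
      Measure.restrict_apply (measurableSet_unitCube k), Set.inter_comm]
  calc gaussLaw r p A = ∫⁻ y in A', g y := h1
    _ ≤ ∫⁻ y in A', (∑' k, (unitCube k).indicator (fun _ ↦ ENNReal.ofReal (nmPMF r p k)) y +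
          ε y * g y) := lintegral_mono fun y ↦ ofReal_gaussDensity_le hb hp hd hr y
    _ = (cubeKernel d ∘ₘ nmMeasure r p) A + ∫⁻ y in A', ε y * g y := by
        rw [lintegral_add_left (Measurable.tsum hcm), h3]
    _ ≤ _ := by
        gcongr
        refine (setLIntegral_le_lintegral _ _).trans ?_
        rw [h2]
        exact lintegral_localError_le hb hp (by linarith)

end Kernels

/-- The bound of the Le Cam distance with an explicit constant. -/
lemma leCamDist_nmExperiment_gaussExperiment_le {d : ℕ} {b r : ℝ} (hb : 0 < b) (hd : 1 ≤ d)
    (hr : 0 < r) :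
    leCamDist (nmExperiment d b r hr) (gaussExperiment d b r) ≤
      ENNReal.ofReal ((2 * errorConst b + 4) * d / √r) := by
  have hC := errorConst_nonneg hb
  have hd1 : (1 : ℝ) ≤ d := by exact_mod_cast hd
  have hs0 : 0 < √r := Real.sqrt_pos.2 hr
  have hle : 2 * (errorConst b * d / √r) ≤ (2 * errorConst b + 4) * d / √r := by
    rw [← mul_div_assoc]
    exact div_le_div_of_nonneg_right (by nlinarith) hs0.le
  have hfl : Measurable (floorMap d) := measurable_floorMap
  refine max_le (iInf₂_le_of_le (cubeKernel d) inferInstance (iSup_le fun p ↦ ?_))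
    (iInf₂_le_of_le (Kernel.deterministic (floorMap d) hfl) inferInstance (iSup_le fun p ↦ ?_))
  all_goals
    rcases lt_or_ge r 2 with hr2 | hr2
    -- For r < 2 the summand 4 of the constant suffices: √r ≤ 2 and d ≥ 1 give 4 d / √r ≥ 2.
    · refine (tvNorm_le_two _ _).trans (ENNReal.ofReal_le_ofReal ?_)
      have h2 : √r ≤ 2 := Real.sqrt_le_iff.2 ⟨by norm_num, by linarith⟩
      rw [le_div_iff₀ hs0]
      nlinarith
  · have h : tvNorm (gaussLaw r p.1) (cubeKernel d ∘ₘ (nmExperiment d b r hr p : Measure _)) ≤ _ :=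
      tvNorm_le_of_forall_le_add (E := errorConst b * d / √r) (by positivity) fun A hA ↦
        gaussLaw_le_add hb p.2 hd hr2 hA
    rw [tvNorm_comm]
    exact h.trans (ENNReal.ofReal_le_ofReal hle)
  · refine (tvNorm_le_of_forall_le_add (E := errorConst b * d / √r) (by positivity)
      fun B hB ↦ ?_).trans (ENNReal.ofReal_le_ofReal hle)
    rw [Measure.deterministic_comp_eq_map, Measure.map_apply hfl hB]
    refine (gaussLaw_le_add hb p.2 hd hr2 (hfl hB)).trans ?_
    rw [cubeKernel_comp_nmMeasure_preimage_floorMap]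
    rfl

end NegMultinomial

/-- For every `b > 0` there is a constant `C_b ∈ (0, ∞)`, depending on `b` only, such that for all
dimensions `d ≥ 1` and all real `r > 0` the Le Cam distance between the negative multinomial
experiment and the normal experiment over `Θ_b` is at most `C_b d / √r`. -/
theorem proposition3 (b : ℝ) (hb : 0 < b) :
    ∃ C : ℝ, 0 < C ∧ ∀ (d : ℕ) (_ : 1 ≤ d) (r : ℝ) (hr : 0 < r),
      NegMultinomial.leCamDist (NegMultinomial.nmExperiment d b r hr)
          (NegMultinomial.gaussExperiment d b r) ≤
        ENNReal.ofReal (C * d / √r) := by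
  have hC := NegMultinomial.errorConst_nonneg hb
  exact ⟨2 * NegMultinomial.errorConst b + 4, by positivity, fun _ hd _ hr ↦
    NegMultinomial.leCamDist_nmExperiment_gaussExperiment_le hb hd hr⟩
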